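/- For a positive integer $n$ write $[n]=\{1,\dots,n\}$. A family $\mathcal F\subset 2^{[n]}$ is called partition-free if there are no $F_0,F_1,F_2\in\mathcal F$, not necessarily distinct, with $F_1\cap F_2=\emptyset$ and $F_0=F_1\cup F_2$. (In particular $\emptyset\notin\mathcal F$.) For $n=3m+l$ with $0\le l\le 2$ put $$\mathcal K(n)=\{K\subset[n]: m+1\le |K|\le 2m+1\},$$ for $\mathcal F\subset 2^{[n]}$ let $\mathcal F^d=\{F\subset[n+1]: F\cap[n]\in\mathcal F\}$ be its double, and for $x\in[n]$ put $$\tilde{\mathcal K}_x(n)=\{F\subset[n]: |F|=m,\ x\in F\}\cup\bigl(\mathcal K(n)\setminus\{G\subset[n]: |G|=2m+1,\ x\in G\}\bigr).$$ Theorem. Let $m\ge 6$ and let $n=3m+2$ or $n=3m$. If $\mathcal F\subset 2^{[n]}$ is partition-free, then $$|\mathcal F|\le\sum_{t=m+1}^{2m+1}\binom nt.\qquad(*)$$ Moreover, for $n=3m+2$ the partition-free families attaining equality in $(*)$ are exactly $\mathcal K(3m+2)$ and the families obtained from $\mathcal K(3m+1)^d$ by a permutation of the ground set $[3m+2]$.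 For $n=3m$ the partition-free families attaining equality in $(*)$ are exactly $\mathcal K(3m)$ and the families $\tilde{\mathcal K}_x(3m)$ with $x\in[n]$. -/

import Mathlib

open Finset

/-- A family of subsets of `[n]` is partition-free if it has no members `F₀, F₁, F₂` (not required
to be distinct) with `F₁ ∩ F₂ = ∅` and `F₀ = F₁ ∪ F₂`. -/
def PartitionFree {n : ℕ} (𝓕 : Finset (Finset (Fin n))) : Prop :=
  ¬ ∃ F₀ ∈ 𝓕, ∃ F₁ ∈ 𝓕, ∃ F₂ ∈ 𝓕, F₁ ∩ F₂ = ∅ ∧ F₀ = F₁ ∪ F₂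

/-- The family `K(n) = {K ⊆ [n] : m + 1 ≤ |K| ≤ 2m + 1}`, where `n = 3m + l` with `0 ≤ l ≤ 2`,
that is, `m = n / 3` (integer division). -/
def kleitmanFamily (n : ℕ) : Finset (Finset (Fin n)) :=
  {K | n / 3 + 1 ≤ #K ∧ #K ≤ 2 * (n / 3) + 1}

/-- The double `{F ⊆ [n + 1] : F ∩ [n] ∈ 𝓕}` of a family `𝓕` of subsets of `[n]`; here `[n]` is
identified with the first `n` elements of `[n + 1]`. -/
def doubleFamily {n : ℕ} (𝓕 : Finset (Finset (Fin n))) : Finset (Finset (Fin (n + 1))) :=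
  {F | ({i | i.castSucc ∈ F} : Finset (Fin n)) ∈ 𝓕}

/-- The family obtained from `K(n)`, `m = n / 3`, by adding all `m`-sets that contain `x` and
deleting all `(2m + 1)`-sets that contain `x`. -/
def kleitmanTilde (n : ℕ) (x : Fin n) : Finset (Finset (Fin n)) :=
  ({F | #F = n / 3 ∧ x ∈ F} : Finset (Finset (Fin n))) ∪
    (kleitmanFamily n \ ({G | #G = 2 * (n / 3) + 1 ∧ x ∈ G} : Finset (Finset (Fin n))))

/-- The image of a family under a permutation of the ground set. -/
def permuteFamily {n : ℕ} (σ : Equiv.Perm (Fin n)) (𝓕 : Finset (Finset (Fin n))) :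
    Finset (Finset (Fin n)) :=
  𝓕.image (fun F => F.image σ)

/-! The ground set is cut into a few blocks of prescribed sizes. Which unions of blocks belong to
the family is a 0-1 pattern constrained only by the triples `J`, `K`, `J ∪ K` with `J`, `K`
disjoint, so linear inequalities for such patterns are finite checks. Averaging over all
permutations of the ground set turns each into an inequality between layer densities. Moreover, if
an averaged inequality is tight, it is tight for every placement of the blocks.

Layers are treated in complementary pairs: `layerPair 𝓕 t` is written L(t), and D(t) = 2 - L(t) is
its deficit. It has to be shown that deficits in the middle pay for everything found below. Layers
far below are paid for by `PartitionFree.density_three_parts`, since binomial coefficients at least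
double from layer to layer there.

For n = 3m + 2 the delicate layers m and m - 1 are controlled by
`PartitionFree.density_five_blocks`: 2L(m) + L(m-1) ≤ 4D(m+1) + 3D(m+2). As C(n,m+1) = 2C(n,m), its
leading terms balance exactly.

For n = 3m the ratio C(n,m)/C(n,m-1) is 2 + 1/m, and the extra 1/m must be paid for. Replacing one
element of an m-set may leave the family; `PartitionFree.mul_permAverage_exchange` bounds the
probability of this below by (d(m) + d(2m) - 1)/m, where d is the density, and
`PartitionFree.density_six_blocks` contains the same probability as a term.

In the case of equality all layers are full or empty except four for n = 3m + 2 (sizes m, m + 1, 2m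
+ 1, 2m + 2) and four for n = 3m (sizes m - 1, m, 2m, 2m + 1). Pointwise tightness gives equations
for individual sets. A place where membership changes under one exchange singles out an element, and
connectivity of a Kneser graph (`kneser_connected`) spreads this local information to all sets
(`PartitionFree.structure_two`, `PartitionFree.structure_zero`). -/

/-- The union of the colour classes of `c` whose colours lie in `J`. -/
def blockSet {n r : ℕ} (c : Fin n → Fin r) (J : Finset (Fin r)) : Finset (Fin n) :=
  {i | c i ∈ J}

/-- The indicator of a family of sets. -/
def indicatorOf {n : ℕ} (𝓕 : Finset (Finset (Fin n))) (S : Finset (Fin n)) : ℤ :=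
  if S ∈ 𝓕 then 1 else 0

/-- The proportion of the `k`-element sets that belong to `𝓕`. -/
def density {n : ℕ} (𝓕 : Finset (Finset (Fin n))) (k : ℕ) : ℚ :=
  (#{S ∈ 𝓕 | #S = k} : ℚ) / n.choose k

/-! ### Blocks, indicators and averaging over permutations -/

section

variable {n r : ℕ} {𝓕 : Finset (Finset (Fin n))}

lemma mem_blockSet {c : Fin n → Fin r} {J : Finset (Fin r)} {i : Fin n} :
    i ∈ blockSet c J ↔ c i ∈ J := by
  simp [blockSet]

lemma blockSet_union (c : Fin n → Fin r) (J K : Finset (Fin r)) :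
    blockSet c (J ∪ K) = blockSet c J ∪ blockSet c K := by
  ext i; simp [mem_blockSet]

lemma blockSet_inter (c : Fin n → Fin r) (J K : Finset (Fin r)) :
    blockSet c (J ∩ K) = blockSet c J ∩ blockSet c K := by
  ext i; simp [mem_blockSet]

lemma blockSet_empty (c : Fin n → Fin r) : blockSet c ∅ = ∅ := by
  ext i; simp [mem_blockSet]

lemma blockSet_comp (c : Fin n → Fin r) (σ : Equiv.Perm (Fin n)) (J : Finset (Fin r)) :
    blockSet (c ∘ σ) J = (blockSet c J).map (σ.symm : Fin n ↪ Fin n) := by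
  ext i; simp [mem_blockSet, Finset.mem_map_equiv]

lemma card_blockSet (c : Fin n → Fin r) (J : Finset (Fin r)) :
    #(blockSet c J) = ∑ j ∈ J, #{i | c i = j} := by
  rw [blockSet, Finset.card_eq_sum_card_fiberwise (f := c) (t := J)]
  · refine Finset.sum_congr rfl fun j hj => ?_
    congr 1
    ext i
    simp only [mem_filter, mem_univ, true_and]
    constructor
    · exact fun h => h.2
    · rintro rfl; exact ⟨hj, rfl⟩
  · intro i hi
    simpa using hi

lemma indicatorOf_eq_zero_or_one (S : Finset (Fin n)) :
    indicatorOf 𝓕 S = 0 ∨ indicatorOf 𝓕 S = 1 := by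
  unfold indicatorOf; split_ifs <;> simp

lemma indicatorOf_nonneg (S : Finset (Fin n)) : 0 ≤ indicatorOf 𝓕 S := by
  unfold indicatorOf; split_ifs <;> simp

lemma indicatorOf_le_one (S : Finset (Fin n)) : indicatorOf 𝓕 S ≤ 1 := by
  unfold indicatorOf; split_ifs <;> simp

lemma indicatorOf_eq_one {S : Finset (Fin n)} : indicatorOf 𝓕 S = 1 ↔ S ∈ 𝓕 := by
  unfold indicatorOf; split_ifs with h <;> simp [h]

lemma indicatorOf_eq_zero {S : Finset (Fin n)} : indicatorOf 𝓕 S = 0 ↔ S ∉ 𝓕 := by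
  unfold indicatorOf; split_ifs with h <;> simp [h]

lemma PartitionFree.not_mem (h : PartitionFree 𝓕) {A B C : Finset (Fin n)} (hA : A ∈ 𝓕)
    (hB : B ∈ 𝓕) (hd : Disjoint A B) (hC : A ∪ B = C) : C ∉ 𝓕 := by
  intro hC'
  exact h ⟨C, hC', A, hA, B, hB, disjoint_iff_inter_eq_empty.1 hd, hC.symm⟩

lemma PartitionFree.indicatorOf_add_le (h : PartitionFree 𝓕) {A B C : Finset (Fin n)}
    (hd : Disjoint A B) (hC : A ∪ B = C) :
    indicatorOf 𝓕 A + indicatorOf 𝓕 B + indicatorOf 𝓕 C ≤ 2 := by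
  by_contra hlt
  have hA := indicatorOf_le_one (𝓕 := 𝓕) A
  have hB := indicatorOf_le_one (𝓕 := 𝓕) B
  have hC' := indicatorOf_le_one (𝓕 := 𝓕) C
  exact h.not_mem (indicatorOf_eq_one.1 (by omega)) (indicatorOf_eq_one.1 (by omega)) hd hC
    (indicatorOf_eq_one.1 (by omega))

/-- Two colourings with equally large colour classes differ by a permutation. -/
lemma exists_perm_comp_eq {c c' : Fin n → Fin r}
    (h : ∀ j, #{i | c i = j} = #{i | c' i = j}) : ∃ σ : Equiv.Perm (Fin n), c ∘ σ = c' := by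
  have key : ∀ j, Nonempty ({i // c' i = j} ≃ {i // c i = j}) := fun j => by
    rw [← Fintype.card_eq, Fintype.card_subtype, Fintype.card_subtype, h j]
  let e : ∀ j, {i // c' i = j} ≃ {i // c i = j} := fun j => Classical.choice (key j)
  refine ⟨((Equiv.sigmaFiberEquiv c').symm.trans (Equiv.sigmaCongrRight e)).trans
    (Equiv.sigmaFiberEquiv c), ?_⟩
  funext i
  exact (e (c' i) ⟨i, rfl⟩).2

/-- Colourings with prescribed sizes of the colour classes exist. -/
lemma exists_coloring (a : Fin r → ℕ) (ha : ∑ j, a j = n) :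
    ∃ c : Fin n → Fin r, ∀ j, #{i | c i = j} = a j := by
  have hcard : Fintype.card ((j : Fin r) × Fin (a j)) = Fintype.card (Fin n) := by
    simp [ha]
  let e := Fintype.equivOfCardEq hcard
  refine ⟨fun i => (e.symm i).1, fun j => ?_⟩
  rw [← Fintype.card_subtype]
  exact (Fintype.card_congr ((e.symm.subtypeEquiv fun i => Iff.rfl).trans
    (Equiv.sigmaSubtype j))).trans (Fintype.card_fin _)

lemma exists_perm_map_eq {S T : Finset (Fin n)} (h : #S = #T) :
    ∃ σ : Equiv.Perm (Fin n), S.map (σ : Fin n ↪ Fin n) = T := by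
  have hc : ∀ U : Finset (Fin n), #{i | (if i ∈ U then (1 : Fin 2) else 0) = 1} = #U ∧
      #{i | (if i ∈ U then (1 : Fin 2) else 0) = 0} = n - #U := fun U => by
    constructor
    · congr 1; ext i; simp
    · rw [show ({i | (if i ∈ U then (1 : Fin 2) else 0) = 0} : Finset (Fin n)) = Uᶜ by
        ext i; simp, card_compl, Fintype.card_fin]
  obtain ⟨σ, hσ⟩ := exists_perm_comp_eq (c := fun i => if i ∈ S then (1 : Fin 2) else 0)
    (c' := fun i => if i ∈ T then (1 : Fin 2) else 0) (fun j => by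
      fin_cases j
      · exact (hc S).2.trans (h ▸ (hc T).2.symm)
      · exact (hc S).1.trans (h ▸ (hc T).1.symm))
  refine ⟨σ.symm, ?_⟩
  ext i
  have := congrFun hσ i
  by_cases h1 : σ i ∈ S <;> by_cases h2 : i ∈ T <;> simp_all [Finset.mem_map_equiv]

/-- The average of a function over all permutations of the ground set. -/
def permAverage (n : ℕ) : (Equiv.Perm (Fin n) → ℚ) →ₗ[ℚ] ℚ :=
  ((Fintype.card (Equiv.Perm (Fin n)) : ℚ)⁻¹) • ∑ σ, LinearMap.proj σ

lemma permAverage_apply (f : Equiv.Perm (Fin n) → ℚ) :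
    permAverage n f = (∑ σ, f σ) / Fintype.card (Equiv.Perm (Fin n)) := by
  simp [permAverage, div_eq_inv_mul]

lemma permAverage_const (a : ℚ) : permAverage n (fun _ => a) = a := by
  rw [permAverage_apply, sum_const, card_univ, nsmul_eq_mul, mul_div_assoc, mul_div_cancel₀]
  exact_mod_cast Fintype.card_ne_zero

lemma permAverage_mono {f g : Equiv.Perm (Fin n) → ℚ} (h : ∀ σ, f σ ≤ g σ) :
    permAverage n f ≤ permAverage n g := by
  rw [permAverage_apply, permAverage_apply]
  gcongr with σ
  exact h σ

/-- This is the source of all equality information: a tight averaged inequality becomes an equation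
for every placement of the blocks. -/
lemma eq_of_permAverage_eq {f g : Equiv.Perm (Fin n) → ℚ} (h : ∀ σ, f σ ≤ g σ)
    (hfg : permAverage n f = permAverage n g) : f = g := by
  rw [permAverage_apply, permAverage_apply, div_left_inj' (by
    exact_mod_cast Fintype.card_ne_zero)] at hfg
  funext σ
  exact (Finset.sum_eq_sum_iff_of_le fun τ _ => h τ).1 hfg σ (mem_univ _)

/-- Composition with a permutation carrying one target to another matches the two sets of
permutations, so all C(n, |T|) possible images of `T` are hit equally often. -/
lemma card_perm_map_eq (T : Finset (Fin n)) {S : Finset (Fin n)} (hS : #S = #T) :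
    (#{σ : Equiv.Perm (Fin n) | T.map (σ.symm : Fin n ↪ Fin n) = S} : ℚ) * n.choose #T =
      Fintype.card (Equiv.Perm (Fin n)) := by
  have hconst : ∀ S' ∈ powersetCard #T (univ : Finset (Fin n)),
      #{σ : Equiv.Perm (Fin n) | T.map (σ.symm : Fin n ↪ Fin n) = S'} =
        #{σ : Equiv.Perm (Fin n) | T.map (σ.symm : Fin n ↪ Fin n) = S} := fun S' hS' => by
    obtain ⟨τ, hτ⟩ := exists_perm_map_eq (S := S') (T := S)
      ((mem_powersetCard.1 hS').2.trans hS.symm)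
    refine Finset.card_bij (fun σ _ => σ * τ⁻¹) ?_ ?_ ?_
    · intro σ hσ
      simp only [mem_filter, mem_univ, true_and] at hσ ⊢
      rw [← hτ, ← hσ, map_map]
      congr 1
    · intro σ _ σ' _ h
      exact mul_right_cancel h
    · intro σ hσ
      refine ⟨σ * τ, ?_, by simp⟩
      simp only [mem_filter, mem_univ, true_and] at hσ ⊢
      apply Finset.map_injective (τ : Fin n ↪ Fin n)
      rw [hτ, ← hσ, map_map]
      congr 1
      ext i
      simp [Equiv.Perm.mul_def]
  have h1 := Finset.card_eq_sum_card_fiberwise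
    (s := (univ : Finset (Equiv.Perm (Fin n)))) (t := powersetCard #T (univ : Finset (Fin n)))
    (f := fun σ => T.map (σ.symm : Fin n ↪ Fin n)) (fun σ _ => by
      simp [mem_powersetCard])
  rw [sum_congr rfl hconst, sum_const, card_powersetCard, card_univ, card_univ, Fintype.card_fin,
    smul_eq_mul] at h1
  rw [h1]
  push_cast
  ring

lemma permAverage_indicatorOf_map (𝓕 : Finset (Finset (Fin n))) (T : Finset (Fin n)) :
    permAverage n (fun σ => (indicatorOf 𝓕 (T.map (σ.symm : Fin n ↪ Fin n)) : ℚ)) =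
      density 𝓕 #T := by
  have hchoose : (n.choose #T : ℚ) ≠ 0 := by
    have := Nat.choose_pos (show #T ≤ n by simpa using card_le_univ T)
    positivity
  rw [permAverage_apply, density, div_eq_div_iff (by exact_mod_cast Fintype.card_ne_zero) hchoose]
  have h1 : ∑ σ : Equiv.Perm (Fin n),
      (indicatorOf 𝓕 (T.map (σ.symm : Fin n ↪ Fin n)) : ℚ) =
      ∑ S ∈ 𝓕 with #S = #T,
        (#{σ : Equiv.Perm (Fin n) | T.map (σ.symm : Fin n ↪ Fin n) = S} : ℚ) := by
    simp_rw [card_eq_sum_ones, sum_filter]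
    push_cast
    rw [← sum_filter, sum_comm]
    refine sum_congr rfl fun σ _ => ?_
    rw [sum_ite_eq]
    simp [indicatorOf]
  rw [h1, sum_mul, sum_congr rfl fun S hS => card_perm_map_eq T (mem_filter.1 hS).2, sum_const,
    nsmul_eq_mul]

lemma permAverage_indicatorOf (𝓕 : Finset (Finset (Fin n))) (c : Fin n → Fin r)
    (J : Finset (Fin r)) :
    permAverage n (fun σ => (indicatorOf 𝓕 (blockSet (c ∘ σ) J) : ℚ)) =
      density 𝓕 #(blockSet c J) := by
  simp_rw [blockSet_comp]
  exact permAverage_indicatorOf_map 𝓕 _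

end

/-! ### Layer densities and the three-part inequality -/

section

variable {n r : ℕ} {𝓕 : Finset (Finset (Fin n))}

lemma density_nonneg (𝓕 : Finset (Finset (Fin n))) (k : ℕ) : 0 ≤ density 𝓕 k := by
  unfold density; positivity

lemma card_layer_le (𝓕 : Finset (Finset (Fin n))) (k : ℕ) : #{S ∈ 𝓕 | #S = k} ≤ n.choose k := by
  calc #{S ∈ 𝓕 | #S = k} ≤ #(powersetCard k (univ : Finset (Fin n))) := by
        refine card_le_card fun S hS => ?_
        simpa [mem_powersetCard] using (mem_filter.1 hS).2
    _ = n.choose k := by simp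

lemma density_le_one (𝓕 : Finset (Finset (Fin n))) (k : ℕ) : density 𝓕 k ≤ 1 :=
  div_le_one_of_le₀ (by exact_mod_cast card_layer_le 𝓕 k) (by positivity)

lemma choose_mul_density (𝓕 : Finset (Finset (Fin n))) (k : ℕ) :
    n.choose k * density 𝓕 k = #{S ∈ 𝓕 | #S = k} := by
  rcases Nat.eq_zero_or_pos (n.choose k) with h | h
  · have := card_layer_le 𝓕 k
    rw [h, Nat.le_zero] at this
    rw [h, this]; simp
  · unfold density
    field_simp

lemma density_eq_zero_iff {k : ℕ} : density 𝓕 k = 0 ↔ ∀ S, #S = k → S ∉ 𝓕 := by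
  have h : density 𝓕 k = 0 ↔ #{S ∈ 𝓕 | #S = k} = 0 := by
    constructor
    · intro h
      have := choose_mul_density 𝓕 k
      rw [h, mul_zero] at this
      exact_mod_cast this.symm
    · intro h
      simp [density, h]
  rw [h, card_eq_zero, filter_eq_empty_iff]
  exact ⟨fun h S hS hF => h hF hS, fun h S hF hS => h S hS hF⟩

lemma density_eq_one_iff {k : ℕ} (hk : k ≤ n) : density 𝓕 k = 1 ↔ ∀ S, #S = k → S ∈ 𝓕 := by
  have hpos := Nat.choose_pos hk
  have h : density 𝓕 k = 1 ↔ #{S ∈ 𝓕 | #S = k} = n.choose k := by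
    rw [density, div_eq_one_iff_eq (by positivity)]
    norm_cast
  have hsub : ({S ∈ 𝓕 | #S = k} : Finset _) ⊆ powersetCard k univ := fun S hS => by
    simpa [mem_powersetCard] using (mem_filter.1 hS).2
  rw [h]
  constructor
  · intro h S hS
    have := eq_of_subset_of_card_le hsub (by simp [h])
    have hS' : S ∈ powersetCard k (univ : Finset (Fin n)) := by simpa [mem_powersetCard] using hS
    rw [← this] at hS'
    exact (mem_filter.1 hS').1
  · intro h
    rw [show ({S ∈ 𝓕 | #S = k} : Finset _) = powersetCard k univ from
      hsub.antisymm fun S hS => by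
        have := (mem_powersetCard.1 hS).2
        exact mem_filter.2 ⟨h S this, this⟩]
    simp

lemma card_eq_sum_choose_mul_density (𝓕 : Finset (Finset (Fin n))) :
    (#𝓕 : ℚ) = ∑ k ∈ range (n + 1), n.choose k * density 𝓕 k := by
  simp_rw [choose_mul_density]
  rw [card_eq_sum_card_fiberwise (f := card) (t := range (n + 1))]
  · push_cast; rfl
  · intro S _
    have := card_le_univ S
    simp at this ⊢
    omega

/-- The indicator of a random recolouring of a block. -/
def blockIndicator (𝓕 : Finset (Finset (Fin n))) (c : Fin n → Fin r) (J : Finset (Fin r)) :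
    Equiv.Perm (Fin n) → ℚ :=
  fun σ => (indicatorOf 𝓕 (blockSet (c ∘ σ) J) : ℚ)

lemma permAverage_blockIndicator (𝓕 : Finset (Finset (Fin n))) {c : Fin n → Fin r}
    {a : Fin r → ℕ} (hc : ∀ j, #{i | c i = j} = a j) (J : Finset (Fin r)) :
    permAverage n (blockIndicator 𝓕 c J) = density 𝓕 (∑ j ∈ J, a j) := by
  unfold blockIndicator
  rw [permAverage_indicatorOf, card_blockSet, sum_congr rfl fun j _ => hc j]

lemma PartitionFree.block_add_le (h : PartitionFree 𝓕) (c : Fin n → Fin r)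
    {J K L : Finset (Fin r)} (hd : Disjoint J K) (hL : J ∪ K = L) :
    indicatorOf 𝓕 (blockSet c J) + indicatorOf 𝓕 (blockSet c K) +
      indicatorOf 𝓕 (blockSet c L) ≤ 2 := by
  refine h.indicatorOf_add_le ?_ ?_
  · rw [disjoint_iff_inter_eq_empty] at hd ⊢
    rw [← blockSet_inter, hd, blockSet_empty]
  · rw [← hL, blockSet_union]

/-- For every partition of the ground set into three parts, at most four of the parts and of
their complements belong to a partition-free family. -/
lemma PartitionFree.density_three_parts (h : PartitionFree 𝓕) {a b c : ℕ} (hn : a + b + c = n) :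
    density 𝓕 a + density 𝓕 b + density 𝓕 c + density 𝓕 (b + c) + density 𝓕 (a + c) +
      density 𝓕 (a + b) ≤ 4 := by
  obtain ⟨col, hcol⟩ := exists_coloring (n := n) ![a, b, c] (by simp [Fin.sum_univ_succ]; omega)
  have key := permAverage_mono (n := n)
    (f := blockIndicator 𝓕 col {0} + blockIndicator 𝓕 col {1} + blockIndicator 𝓕 col {2} +
      blockIndicator 𝓕 col {1, 2} + blockIndicator 𝓕 col {0, 2} + blockIndicator 𝓕 col {0, 1})
    (g := fun _ => 4) (fun σ => by
      simp only [Pi.add_apply, blockIndicator]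
      -- If s of the three parts are members, then s(s-1)/2 of the pairwise unions are excluded,
      -- which leaves at most 3, 4, 4, 3 members for s = 0, 1, 2, 3.
      have h1 := h.block_add_le (col ∘ σ) (J := {0}) (K := {1}) (L := {0, 1}) (by decide) (by decide)
      have h2 := h.block_add_le (col ∘ σ) (J := {0}) (K := {2}) (L := {0, 2}) (by decide) (by decide)
      have h3 := h.block_add_le (col ∘ σ) (J := {1}) (K := {2}) (L := {1, 2}) (by decide) (by decide)
      have hz := fun J => indicatorOf_eq_zero_or_one (𝓕 := 𝓕) (blockSet (col ∘ σ) J)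
      generalize (fun J => indicatorOf 𝓕 (blockSet (col ∘ σ) J)) = q at *
      have h4 := hz {0}
      have h5 := hz {1}
      have h6 := hz {2}
      have h7 := hz {0, 1}
      have h8 := hz {0, 2}
      have h9 := hz {1, 2}
      norm_cast
      omega)
  simpa only [map_add, permAverage_const, permAverage_blockIndicator 𝓕 hcol, sum_singleton,
    sum_pair (show (1 : Fin 3) ≠ 2 by decide), sum_pair (show (0 : Fin 3) ≠ 2 by decide),
    sum_pair (show (0 : Fin 3) ≠ 1 by decide), Matrix.cons_val] using key

end

/-! ### Configuration inequalities on five and six blocks -/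

/-- Colours `0, 1, 2, 3, 4` stand for parts of sizes `m - 1, 1, m + 1, 1, m`. -/
lemma five_block_inequality (q : Finset (Fin 5) → ℤ) (hz : ∀ J, q J = 0 ∨ q J = 1)
    (h : ∀ J K L, Disjoint J K → J ∪ K = L → q J + q K + q L ≤ 2) :
    (q {0, 1} + q {2, 3, 4}) + (q {4} + q {0, 1, 2, 3}) + (q {0} + q {1, 2, 3, 4}) + 2 * (q {2}
      + q {0, 1, 3, 4}) + (q {3, 4} + q {0, 1, 2}) + (q {0, 1, 3} + q {2, 4}) + (q {1, 3, 4} + q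
      {0, 2}) + (q {1, 2} + q {0, 3, 4}) + (q {2, 3} + q {0, 1, 4}) ≤ 14 := by
  -- Nine complementary pairs of unions occur, hence eighteen 0-1 unknowns. Fifteen of the
  -- disjoint-union constraints reduce the claim to integer arithmetic.
  have h0 := h {0, 1} {4} {0, 1, 4} (by decide) (by decide)
  have h1 := h {0, 1} {2} {0, 1, 2} (by decide) (by decide)
  have h2 := h {0, 1} {3, 4} {0, 1, 3, 4} (by decide) (by decide)
  have h3 := h {0, 1} {2, 3} {0, 1, 2, 3} (by decide) (by decide)
  have h4 := h {4} {2} {2, 4} (by decide) (by decide)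
  have h5 := h {4} {0, 1, 3} {0, 1, 3, 4} (by decide) (by decide)
  have h6 := h {4} {2, 3} {2, 3, 4} (by decide) (by decide)
  have h7 := h {0} {2} {0, 2} (by decide) (by decide)
  have h8 := h {0} {3, 4} {0, 3, 4} (by decide) (by decide)
  have h9 := h {0} {1, 3, 4} {0, 1, 3, 4} (by decide) (by decide)
  have h10 := h {0} {1, 2} {0, 1, 2} (by decide) (by decide)
  have h11 := h {2} {3, 4} {2, 3, 4} (by decide) (by decide)
  have h12 := h {2} {0, 1, 3} {0, 1, 2, 3} (by decide) (by decide)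
  have h13 := h {2} {1, 3, 4} {1, 2, 3, 4} (by decide) (by decide)
  have h14 := h {3, 4} {1, 2} {1, 2, 3, 4} (by decide) (by decide)
  have z01 := hz {0, 1}
  have z234 := hz {2, 3, 4}
  have z4 := hz {4}
  have z0123 := hz {0, 1, 2, 3}
  have z0 := hz {0}
  have z1234 := hz {1, 2, 3, 4}
  have z2 := hz {2}
  have z0134 := hz {0, 1, 3, 4}
  have z34 := hz {3, 4}
  have z012 := hz {0, 1, 2}
  have z013 := hz {0, 1, 3}
  have z24 := hz {2, 4}
  have z134 := hz {1, 3, 4}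
  have z02 := hz {0, 2}
  have z12 := hz {1, 2}
  have z034 := hz {0, 3, 4}
  have z23 := hz {2, 3}
  have z014 := hz {0, 1, 4}
  generalize q {0, 1} = x01 at *
  generalize q {2, 3, 4} = x234 at *
  generalize q {4} = x4 at *
  generalize q {0, 1, 2, 3} = x0123 at *
  generalize q {0} = x0 at *
  generalize q {1, 2, 3, 4} = x1234 at *
  generalize q {2} = x2 at *
  generalize q {0, 1, 3, 4} = x0134 at *
  generalize q {3, 4} = x34 at *
  generalize q {0, 1, 2} = x012 at *
  generalize q {0, 1, 3} = x013 at *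
  generalize q {2, 4} = x24 at *
  generalize q {1, 3, 4} = x134 at *
  generalize q {0, 2} = x02 at *
  generalize q {1, 2} = x12 at *
  generalize q {0, 3, 4} = x034 at *
  generalize q {2, 3} = x23 at *
  generalize q {0, 1, 4} = x014 at *
  clear h hz
  omega

/-- Here m = k + 1. The bound 14 = 2·4 + 2·3 is what full layers m + 1, m + 2 and their complements
already use up, so anything in the layers m and m - 1 is paid for by deficits there. -/
lemma PartitionFree.density_five_blocks {n k : ℕ} {𝓕 : Finset (Finset (Fin n))}
    (h : PartitionFree 𝓕) (hn : n = 3 * k + 5) :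
    2 * (density 𝓕 (k + 1) + density 𝓕 (2 * k + 4)) + (density 𝓕 k + density 𝓕 (2 * k + 5)) +
      4 * (density 𝓕 (k + 2) + density 𝓕 (2 * k + 3)) +
      3 * (density 𝓕 (k + 3) + density 𝓕 (2 * k + 2)) ≤ 14 := by
  obtain ⟨c, hc⟩ := exists_coloring (n := n) ![k, 1, k + 2, 1, k + 1]
    (by simp [Fin.sum_univ_succ]; omega)
  have A : ∀ J t, ∑ j ∈ J, (![k, 1, k + 2, 1, k + 1] : Fin 5 → ℕ) j = t →
      permAverage n (blockIndicator 𝓕 c J) = density 𝓕 t := fun J t hJ => by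
    rw [permAverage_blockIndicator 𝓕 hc, hJ]
  have key := permAverage_mono (n := n)
    (f := (blockIndicator 𝓕 c {0, 1} + blockIndicator 𝓕 c {2, 3, 4}) + (blockIndicator 𝓕 c {4} +
      blockIndicator 𝓕 c {0, 1, 2, 3}) + (blockIndicator 𝓕 c {0} + blockIndicator 𝓕 c {1, 2, 3,
      4}) + (2 : ℚ) • (blockIndicator 𝓕 c {2} + blockIndicator 𝓕 c {0, 1, 3, 4}) +
      (blockIndicator 𝓕 c {3, 4} + blockIndicator 𝓕 c {0, 1, 2}) + (blockIndicator 𝓕 c {0, 1, 3}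
      + blockIndicator 𝓕 c {2, 4}) + (blockIndicator 𝓕 c {1, 3, 4} + blockIndicator 𝓕 c {0, 2})
      + (blockIndicator 𝓕 c {1, 2} + blockIndicator 𝓕 c {0, 3, 4}) + (blockIndicator 𝓕 c {2, 3}
      + blockIndicator 𝓕 c {0, 1, 4}))
    (g := fun _ => 14) (fun σ => by
      simp only [Pi.add_apply, Pi.smul_apply, smul_eq_mul, blockIndicator]
      exact_mod_cast five_block_inequality (fun J => indicatorOf 𝓕 (blockSet (c ∘ σ) J))
        (fun J => indicatorOf_eq_zero_or_one _) fun J K L => h.block_add_le (c ∘ σ))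
  simp only [map_add, map_smul, smul_eq_mul, permAverage_const] at key
  rw [A {0, 1} (k + 1) (by simp), A {2, 3, 4} (2 * k + 4) (by simp; omega), A {4} (k + 1) (by simp),
    A {0, 1, 2, 3} (2 * k + 4) (by simp; omega), A {0} (k) (by simp),
    A {1, 2, 3, 4} (2 * k + 5) (by simp; omega), A {2} (k + 2) (by simp),
    A {0, 1, 3, 4} (2 * k + 3) (by simp; omega), A {3, 4} (k + 2) (by simp; omega),
    A {0, 1, 2} (2 * k + 3) (by simp; omega), A {0, 1, 3} (k + 2) (by simp),
    A {2, 4} (2 * k + 3) (by simp; omega), A {1, 3, 4} (k + 3) (by simp; omega),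
    A {0, 2} (2 * k + 2) (by simp; omega), A {1, 2} (k + 3) (by simp; omega),
    A {0, 3, 4} (2 * k + 2) (by simp; omega), A {2, 3} (k + 3) (by simp),
    A {0, 1, 4} (2 * k + 2) (by simp; omega)] at key
  linarith

/-- Colours `0, …, 5` stand for parts of sizes `m - 2, 1, 1, m - 1, 1, m`. -/
lemma six_block_inequality (q : Finset (Fin 6) → ℤ) (hz : ∀ J, q J = 0 ∨ q J = 1)
    (h : ∀ J K L, Disjoint J K → J ∪ K = L → q J + q K + q L ≤ 2) :
    2 * (q {3, 4} * (1 - q {2, 3})) + 2 * q {2, 3} + 2 * q {5} + 2 * q {3} + q {0} + q {1, 2, 3,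
      4, 5} + 2 * q {2, 3, 4, 5} + 2 * q {4, 5} + 2 * q {2, 5} + 2 * q {2, 3, 4} + q {1, 2, 3} +
      q {0, 4, 5} + q {0, 1, 2, 3} + 2 * q {3, 4, 5} + 2 * q {2, 3, 5} + 2 * q {3, 5} + 3 * q
      {1, 4, 5} + q {0, 2, 3} + q {1, 2, 5} + q {1, 2, 3, 4} + q {0, 3, 4} + q {0, 5} ≤ 25 := by
  -- The product term plus `2 * q {2, 3}` is twice the maximum of `q {2, 3}` and `q {3, 4}`. Once
  -- these two values are fixed by cases the problem is linear.
  have hb : ∀ J, 0 ≤ q J ∧ q J ≤ 1 := fun J => by rcases hz J with h | h <;> omega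
  have h0 := h {2, 3} {5} {2, 3, 5} (by decide) (by decide)
  have h1 := h {2, 3} {0} {0, 2, 3} (by decide) (by decide)
  have h2 := h {2, 3} {4, 5} {2, 3, 4, 5} (by decide) (by decide)
  have h3 := h {2, 3} {1, 4, 5} {1, 2, 3, 4, 5} (by decide) (by decide)
  have h4 := h {5} {3, 4} {3, 4, 5} (by decide) (by decide)
  have h5 := h {5} {3} {3, 5} (by decide) (by decide)
  have h6 := h {5} {0} {0, 5} (by decide) (by decide)
  have h7 := h {5} {2, 3, 4} {2, 3, 4, 5} (by decide) (by decide)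
  have h8 := h {5} {1, 2, 3, 4} {1, 2, 3, 4, 5} (by decide) (by decide)
  have h9 := h {3, 4} {0} {0, 3, 4} (by decide) (by decide)
  have h10 := h {3, 4} {2, 5} {2, 3, 4, 5} (by decide) (by decide)
  have h11 := h {3, 4} {1, 2, 5} {1, 2, 3, 4, 5} (by decide) (by decide)
  have h12 := h {3} {4, 5} {3, 4, 5} (by decide) (by decide)
  have h13 := h {3} {2, 5} {2, 3, 5} (by decide) (by decide)
  have h14 := h {0} {4, 5} {0, 4, 5} (by decide) (by decide)
  have h15 := h {0} {1, 2, 3} {0, 1, 2, 3} (by decide) (by decide)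
  have h16 := h {4, 5} {1, 2, 3} {1, 2, 3, 4, 5} (by decide) (by decide)
  have z23 := hz {2, 3}
  have z5 := hz {5}
  have z34 := hz {3, 4}
  have z3 := hz {3}
  have z0 := hz {0}
  have z12345 := hb {1, 2, 3, 4, 5}
  have z2345 := hz {2, 3, 4, 5}
  have z45 := hb {4, 5}
  have z25 := hb {2, 5}
  have z234 := hb {2, 3, 4}
  have z123 := hb {1, 2, 3}
  have z045 := hb {0, 4, 5}
  have z0123 := hb {0, 1, 2, 3}
  have z345 := hb {3, 4, 5}
  have z235 := hb {2, 3, 5}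
  have z35 := hb {3, 5}
  have z145 := hb {1, 4, 5}
  have z023 := hb {0, 2, 3}
  have z125 := hb {1, 2, 5}
  have z1234 := hb {1, 2, 3, 4}
  have z034 := hb {0, 3, 4}
  have z05 := hb {0, 5}
  generalize q {2, 3} = x23 at *
  generalize q {5} = x5 at *
  generalize q {3, 4} = x34 at *
  generalize q {3} = x3 at *
  generalize q {0} = x0 at *
  generalize q {1, 2, 3, 4, 5} = x12345 at *
  generalize q {2, 3, 4, 5} = x2345 at *
  generalize q {4, 5} = x45 at *
  generalize q {2, 5} = x25 at *
  generalize q {2, 3, 4} = x234 at *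
  generalize q {1, 2, 3} = x123 at *
  generalize q {0, 4, 5} = x045 at *
  generalize q {0, 1, 2, 3} = x0123 at *
  generalize q {3, 4, 5} = x345 at *
  generalize q {2, 3, 5} = x235 at *
  generalize q {3, 5} = x35 at *
  generalize q {1, 4, 5} = x145 at *
  generalize q {0, 2, 3} = x023 at *
  generalize q {1, 2, 5} = x125 at *
  generalize q {1, 2, 3, 4} = x1234 at *
  generalize q {0, 3, 4} = x034 at *
  generalize q {0, 5} = x05 at *
  clear h hz hb
  rcases z23 with rfl | rfl <;> rcases z34 with rfl | rfl <;> rcases z5 with rfl | rfl <;>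
    rcases z3 with rfl | rfl <;> rcases z2345 with rfl | rfl <;> rcases z0 with rfl | rfl <;>
    omega

/-- Here m = k + 2. The blocks {3, 4} and {2, 3} are m-sets differing in one element. Their product
term is a correlation, not a density, and therefore stays in the form of an average. -/
lemma PartitionFree.density_six_blocks {n k : ℕ} {𝓕 : Finset (Finset (Fin n))}
    (h : PartitionFree 𝓕) {c : Fin n → Fin 6}
    (hc : ∀ j, #{i | c i = j} = (![k, 1, 1, k + 1, 1, k + 2] : Fin 6 → ℕ) j) :
    2 * permAverage n (blockIndicator 𝓕 c {3, 4} * (1 - blockIndicator 𝓕 c {2, 3})) +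
      4 * density 𝓕 (k + 2) + 2 * density 𝓕 (k + 1) + (density 𝓕 k + density 𝓕 (2 * k + 6)) +
      2 * density 𝓕 (2 * k + 5) + 4 * density 𝓕 (2 * k + 4) +
      7 * density 𝓕 (k + 3) + 4 * density 𝓕 (2 * k + 3) +
      5 * density 𝓕 (k + 4) + 3 * density 𝓕 (2 * k + 2) ≤ 25 := by
  have A : ∀ J t, ∑ j ∈ J, (![k, 1, 1, k + 1, 1, k + 2] : Fin 6 → ℕ) j = t →
      permAverage n (blockIndicator 𝓕 c J) = density 𝓕 t := fun J t hJ => by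
    rw [permAverage_blockIndicator 𝓕 hc, hJ]
  have key := permAverage_mono (n := n)
    (f := (2 : ℚ) • (blockIndicator 𝓕 c {3, 4} * (1 - blockIndicator 𝓕 c {2, 3})) + (2 : ℚ) •
      blockIndicator 𝓕 c {2, 3} + (2 : ℚ) • blockIndicator 𝓕 c {5} + (2 : ℚ) • blockIndicator 𝓕
      c {3} + blockIndicator 𝓕 c {0} + blockIndicator 𝓕 c {1, 2, 3, 4, 5} + (2 : ℚ) •
      blockIndicator 𝓕 c {2, 3, 4, 5} + (2 : ℚ) • blockIndicator 𝓕 c {4, 5} + (2 : ℚ) •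
      blockIndicator 𝓕 c {2, 5} + (2 : ℚ) • blockIndicator 𝓕 c {2, 3, 4} + blockIndicator 𝓕 c
      {1, 2, 3} + blockIndicator 𝓕 c {0, 4, 5} + blockIndicator 𝓕 c {0, 1, 2, 3} + (2 : ℚ) •
      blockIndicator 𝓕 c {3, 4, 5} + (2 : ℚ) • blockIndicator 𝓕 c {2, 3, 5} + (2 : ℚ) •
      blockIndicator 𝓕 c {3, 5} + (3 : ℚ) • blockIndicator 𝓕 c {1, 4, 5} + blockIndicator 𝓕 c
      {0, 2, 3} + blockIndicator 𝓕 c {1, 2, 5} + blockIndicator 𝓕 c {1, 2, 3, 4} +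
      blockIndicator 𝓕 c {0, 3, 4} + blockIndicator 𝓕 c {0, 5})
    (g := fun _ => 25) (fun σ => by
      simp only [Pi.add_apply, Pi.smul_apply, Pi.mul_apply, Pi.sub_apply, Pi.one_apply,
        smul_eq_mul, blockIndicator]
      exact_mod_cast six_block_inequality (fun J => indicatorOf 𝓕 (blockSet (c ∘ σ) J))
        (fun J => indicatorOf_eq_zero_or_one _) fun J K L => h.block_add_le (c ∘ σ))
  simp only [map_add, map_smul, smul_eq_mul, permAverage_const] at key
  rw [A {2, 3} (k + 2) (by simp; omega), A {5} (k + 2) (by simp), A {3} (k + 1) (by simp),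
    A {0} (k) (by simp), A {1, 2, 3, 4, 5} (2 * k + 6) (by simp; omega),
    A {2, 3, 4, 5} (2 * k + 5) (by simp; omega), A {4, 5} (k + 3) (by simp; omega),
    A {2, 5} (k + 3) (by simp; omega), A {2, 3, 4} (k + 3) (by simp; omega),
    A {1, 2, 3} (k + 3) (by simp; omega), A {0, 4, 5} (2 * k + 3) (by simp; omega),
    A {0, 1, 2, 3} (2 * k + 3) (by simp; omega), A {3, 4, 5} (2 * k + 4) (by simp; omega),
    A {2, 3, 5} (2 * k + 4) (by simp; omega), A {3, 5} (2 * k + 3) (by simp; omega),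
    A {1, 4, 5} (k + 4) (by simp; omega), A {0, 2, 3} (2 * k + 2) (by simp; omega),
    A {1, 2, 5} (k + 4) (by simp; omega), A {1, 2, 3, 4} (k + 4) (by simp; omega),
    A {0, 3, 4} (2 * k + 2) (by simp; omega), A {0, 5} (2 * k + 2) (by simp; omega)] at key
  linarith

/-! ### Exchanges of one element and their averages -/

section

variable {n r : ℕ} {𝓕 : Finset (Finset (Fin n))}

/-- The three given sizes determine the sizes of the four cells of the Venn diagram of the pair, so
colouring the points by cells reduces this to `exists_perm_comp_eq`. -/
lemma exists_perm_map_pair_eq {S T S' T' : Finset (Fin n)} (hS : #S = #S') (hT : #T = #T')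
    (hST : #(S ∩ T) = #(S' ∩ T')) :
    ∃ σ : Equiv.Perm (Fin n), S.map (σ.symm : Fin n ↪ Fin n) = S' ∧
      T.map (σ.symm : Fin n ↪ Fin n) = T' := by
  let col : Finset (Fin n) → Finset (Fin n) → Fin n → Fin 4 := fun S T i =>
    if i ∈ S then (if i ∈ T then 0 else 1) else (if i ∈ T then 2 else 3)
  have h0 : ∀ S T, ({i | col S T i = 0} : Finset (Fin n)) = S ∩ T := fun S T => by
    ext i; by_cases h1 : i ∈ S <;> by_cases h2 : i ∈ T <;> simp [col, h1, h2]
  have h1 : ∀ S T, ({i | col S T i = 1} : Finset (Fin n)) = S \ T := fun S T => by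
    ext i; by_cases h1 : i ∈ S <;> by_cases h2 : i ∈ T <;> simp [col, h1, h2]
  have h2 : ∀ S T, ({i | col S T i = 2} : Finset (Fin n)) = T \ S := fun S T => by
    ext i; by_cases h1 : i ∈ S <;> by_cases h2 : i ∈ T <;> simp [col, h1, h2]
  have h3 : ∀ S T, ({i | col S T i = 3} : Finset (Fin n)) = (S ∪ T)ᶜ := fun S T => by
    ext i; by_cases h1 : i ∈ S <;> by_cases h2 : i ∈ T <;> simp [col, h1, h2]
  obtain ⟨σ, hσ⟩ := exists_perm_comp_eq (c := col S T) (c' := col S' T') (fun j => by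
    have e1 := card_sdiff_add_card_inter S T
    have e2 := card_sdiff_add_card_inter S' T'
    have e3 := card_sdiff_add_card_inter T S
    have e4 := card_sdiff_add_card_inter T' S'
    have e5 := card_union_add_card_inter S T
    have e6 := card_union_add_card_inter S' T'
    rw [inter_comm] at e3 e4
    fin_cases j
    · simp only [Fin.zero_eta, h0]; omega
    · simp only [Fin.mk_one, h1]; omega
    · simp only [Fin.reduceFinMk, h2]; omega
    · simp only [Fin.reduceFinMk, h3, card_compl]; omega)
  have hSm : ∀ S T i, i ∈ S ↔ col S T i = 0 ∨ col S T i = 1 := fun S T i => by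
    by_cases h1 : i ∈ S <;> by_cases h2 : i ∈ T <;> simp [col, h1, h2]
  have hTm : ∀ S T i, i ∈ T ↔ col S T i = 0 ∨ col S T i = 2 := fun S T i => by
    by_cases h1 : i ∈ S <;> by_cases h2 : i ∈ T <;> simp [col, h1, h2]
  refine ⟨σ, ?_, ?_⟩
  · ext i
    rw [Finset.mem_map_equiv, Equiv.symm_symm, hSm S T, hSm S' T', ← congrFun hσ i]
    rfl
  · ext i
    rw [Finset.mem_map_equiv, Equiv.symm_symm, hTm S T, hTm S' T', ← congrFun hσ i]
    rfl

/-- The average of a function of a pair of sets depends only on the sizes of the sets and of their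
intersection. -/
lemma permAverage_pair_eq {S T S' T' : Finset (Fin n)} (hS : #S = #S') (hT : #T = #T')
    (hST : #(S ∩ T) = #(S' ∩ T')) (f : Finset (Fin n) → Finset (Fin n) → ℚ) :
    permAverage n (fun σ => f (S.map (σ.symm : Fin n ↪ Fin n)) (T.map (σ.symm : Fin n ↪ Fin n))) =
      permAverage n
        (fun σ => f (S'.map (σ.symm : Fin n ↪ Fin n)) (T'.map (σ.symm : Fin n ↪ Fin n))) := by
  obtain ⟨τ, rfl, rfl⟩ := exists_perm_map_pair_eq hS hT hST
  rw [permAverage_apply, permAverage_apply]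
  congr 1
  rw [← Equiv.sum_comp (Equiv.mulLeft τ)]
  refine Fintype.sum_congr _ _ fun σ => ?_
  simp only [map_map]
  congr 2

/-- The elements of `Fin n` with values in `[a, b)`. -/
def finSegment (n a b : ℕ) : Finset (Fin n) :=
  {i | a ≤ i.val ∧ i.val < b}

lemma card_finSegment {a b : ℕ} (hb : b ≤ n) : #(finSegment n a b) = b - a := by
  rw [← Nat.card_Ico, ← card_map Fin.valEmbedding]
  congr 1
  ext i
  simp only [finSegment, mem_map, mem_filter, mem_univ, true_and, Fin.valEmbedding_apply, mem_Ico]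
  constructor
  · rintro ⟨j, hj, rfl⟩; exact hj
  · intro hi; exact ⟨⟨i, by omega⟩, hi, rfl⟩

/-- A 0-1 sequence that starts at 1 and ends at 0 must step from 1 to 0 somewhere. -/
lemma le_sum_mul_one_sub (s : ℕ → ℚ) (hs : ∀ j, s j = 0 ∨ s j = 1) (m : ℕ) :
    s 0 * (1 - s m) ≤ ∑ j ∈ range m, s j * (1 - s (j + 1)) := by
  induction m with
  | zero => rcases hs 0 with h | h <;> simp [h]
  | succ m ih =>
    rw [sum_range_succ]
    have : s 0 * (1 - s (m + 1)) ≤ s 0 * (1 - s m) + s m * (1 - s (m + 1)) := by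
      rcases hs 0 with h | h <;> rcases hs m with h' | h' <;> rcases hs (m + 1) with h'' | h'' <;>
        simp [h, h', h'']
    linarith

/-- Along a path of `m` exchanges joining two disjoint `m`-sets, a partition-free family containing
all `2m`-sets must be left at least once. -/
lemma PartitionFree.mul_permAverage_exchange (h : PartitionFree 𝓕) {m : ℕ} (hm : 2 * m ≤ n)
    {X X' : Finset (Fin n)} (hX : #X = m) (hX' : #X' = m) (hXX' : #(X ∩ X') + 1 = m) :
    density 𝓕 m + density 𝓕 (2 * m) - 1 ≤ m * permAverage n (fun σ =>
      (indicatorOf 𝓕 (X.map (σ.symm : Fin n ↪ Fin n)) : ℚ) *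
        (1 - (indicatorOf 𝓕 (X'.map (σ.symm : Fin n ↪ Fin n)) : ℚ))) := by
  -- Sliding windows of length m: neighbours differ by one exchange, while the windows at 0 and m
  -- are disjoint with union the initial segment of length 2m.
  let S : ℕ → Finset (Fin n) := fun j => finSegment n j (j + m)
  let s : ℕ → Equiv.Perm (Fin n) → ℚ := fun j σ =>
    (indicatorOf 𝓕 ((S j).map (σ.symm : Fin n ↪ Fin n)) : ℚ)
  let u : Equiv.Perm (Fin n) → ℚ := fun σ =>
    (indicatorOf 𝓕 ((finSegment n 0 (2 * m)).map (σ.symm : Fin n ↪ Fin n)) : ℚ)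
  have hcard : ∀ j, j + m ≤ n → #(S j) = m := fun j hj => by
    rw [card_finSegment hj]; omega
  have hstep : ∀ j ∈ range m, permAverage n (s j * (1 - s (j + 1))) = permAverage n (fun σ =>
      (indicatorOf 𝓕 (X.map (σ.symm : Fin n ↪ Fin n)) : ℚ) *
        (1 - (indicatorOf 𝓕 (X'.map (σ.symm : Fin n ↪ Fin n)) : ℚ))) := fun j hj => by
    have hj := mem_range.1 hj
    refine permAverage_pair_eq (S := S j) (T := S (j + 1)) ?_ ?_ ?_
      (fun A B => (indicatorOf 𝓕 A : ℚ) * (1 - (indicatorOf 𝓕 B : ℚ)))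
    · rw [hX, hcard j (by omega)]
    · rw [hX', hcard (j + 1) (by omega)]
    · rw [show S j ∩ S (j + 1) = finSegment n (j + 1) (j + m) by
        ext i; simp [S, finSegment]; omega, card_finSegment (by omega)]
      omega
  have key := permAverage_mono (n := n) (f := s 0 + u - fun _ => 1)
    (g := ∑ j ∈ range m, s j * (1 - s (j + 1))) (fun σ => by
      have h1 := le_sum_mul_one_sub (fun j => s j σ) (fun j => by
        rcases indicatorOf_eq_zero_or_one (𝓕 := 𝓕) ((S j).map (σ.symm : Fin n ↪ Fin n)) with h | h
          <;> simp [s, h]) m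
      have h2 : s 0 σ + s m σ + u σ ≤ 2 := by
        simp only [s, u]
        norm_cast
        refine h.indicatorOf_add_le ((disjoint_map _).2 ?_) ?_
        · rw [disjoint_left]
          intro i hi hi'
          simp only [S, finSegment, mem_filter] at hi hi'
          omega
        · rw [← map_union]
          congr 1
          ext i; simp only [S, finSegment, mem_union, mem_filter, mem_univ, true_and]; omega
      have h3 : s 0 σ ≤ 1 := by simp only [s]; exact_mod_cast indicatorOf_le_one _
      have h4 : 0 ≤ s 0 σ := by simp only [s]; exact_mod_cast indicatorOf_nonneg _
      have h5 : s m σ ≤ 1 := by simp only [s]; exact_mod_cast indicatorOf_le_one _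
      have h6 : u σ ≤ 1 := by simp only [u]; exact_mod_cast indicatorOf_le_one _
      have h7 : s 0 σ = 0 ∨ s 0 σ = 1 := by
        rcases indicatorOf_eq_zero_or_one (𝓕 := 𝓕) ((S 0).map (σ.symm : Fin n ↪ Fin n)) with h | h
          <;> simp [s, h]
      simp only [Pi.add_apply, Pi.sub_apply, Finset.sum_apply, Pi.mul_apply, Pi.one_apply]
      rcases h7 with h7 | h7 <;> rw [h7] at h1 h2 ⊢ <;> linarith)
  rw [map_sub, map_add, map_sum, sum_congr rfl hstep, sum_const, card_range, nsmul_eq_mul,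
    permAverage_const] at key
  have e1 : permAverage n (s 0) = density 𝓕 m := by
    rw [show s 0 = fun σ => (indicatorOf 𝓕 ((S 0).map (σ.symm : Fin n ↪ Fin n)) : ℚ) from rfl,
      permAverage_indicatorOf_map, hcard 0 (by omega)]
  have e2 : permAverage n u = density 𝓕 (2 * m) := by
    rw [permAverage_indicatorOf_map, card_finSegment hm, Nat.sub_zero]
  rwa [e1, e2] at key

end

/-! ### Binomial estimates, complementary pairs of layers, and the deficiency for n = 3m + 2 -/

section

variable {n : ℕ} {𝓕 : Finset (Finset (Fin n))}

lemma two_mul_choose_le_choose_succ {k : ℕ} (h : 3 * k + 2 ≤ n) :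
    2 * n.choose k ≤ n.choose (k + 1) := by
  have h1 := Nat.choose_succ_right_eq n k
  have h2 : 2 * (k + 1) ≤ n - k := by omega
  refine Nat.le_of_mul_le_mul_right (c := k + 1) ?_ (by omega)
  rw [h1]
  nlinarith [Nat.zero_le (n.choose k)]

/-- This exact factor 2 is what lets the layers m and m + 1 balance without loss when n = 3m + 2. -/
lemma choose_succ_eq_two_mul_choose {k : ℕ} (h : n = 3 * k + 2) :
    n.choose (k + 1) = 2 * n.choose k := by
  have h1 := Nat.choose_succ_right_eq n k
  rw [show n - k = 2 * (k + 1) by omega] at h1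
  refine Nat.eq_of_mul_eq_mul_right (show 0 < k + 1 by omega) ?_
  rw [h1]; ring

lemma choose_le_choose_of_add_le {a b : ℕ} (hab : a ≤ b) (h : a + b ≤ n) :
    n.choose a ≤ n.choose b := by
  have mono : ∀ c, a ≤ c → 2 * c ≤ n → n.choose a ≤ n.choose c := fun c hac => by
    induction c, hac using Nat.le_induction with
    | base => exact fun _ => le_rfl
    | succ c hc ih =>
      intro h
      exact (ih (by omega)).trans (Nat.choose_le_succ_of_lt_half_left (by omega))
  by_cases hb : 2 * b ≤ n
  · exact mono b hab hb
  · rw [← Nat.choose_symm (show b ≤ n by omega)]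
    exact mono (n - b) (by omega) (by omega)

/-- Three doublings lead from t to t + 3, and u is at least as close to n/2 as t + 3. -/
lemma eight_mul_choose_le {t u : ℕ} (h : 3 * t + 8 ≤ n) (htu : t + 3 ≤ u)
    (hu : t + 3 + u ≤ n) : 8 * n.choose t ≤ n.choose u := by
  have h1 := two_mul_choose_le_choose_succ (n := n) (k := t) (by omega)
  have h2 := two_mul_choose_le_choose_succ (n := n) (k := t + 1) (by omega)
  have h3 := two_mul_choose_le_choose_succ (n := n) (k := t + 2) (by omega)
  have h4 := choose_le_choose_of_add_le htu hu
  simp only [add_assoc, Nat.reduceAdd] at *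
  omega

/-- While layers at least double, each dominates the sum of all those below it. -/
lemma sum_range_choose_le {k : ℕ} (h : 3 * k ≤ n + 1) :
    ∑ t ∈ range k, n.choose t ≤ n.choose k := by
  induction k with
  | zero => simp
  | succ k ih =>
    have := two_mul_choose_le_choose_succ (n := n) (k := k) (by omega)
    rw [sum_range_succ]
    have := ih (by omega)
    omega

/-- The total density of a layer and of the complementary layer. -/
def layerPair (𝓕 : Finset (Finset (Fin n))) (t : ℕ) : ℚ :=
  density 𝓕 t + density 𝓕 (n - t)

lemma layerPair_nonneg (𝓕 : Finset (Finset (Fin n))) (t : ℕ) : 0 ≤ layerPair 𝓕 t :=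
  add_nonneg (density_nonneg _ _) (density_nonneg _ _)

lemma layerPair_le_two (𝓕 : Finset (Finset (Fin n))) (t : ℕ) : layerPair 𝓕 t ≤ 2 := by
  have h1 := density_le_one 𝓕 t
  have h2 := density_le_one 𝓕 (n - t)
  unfold layerPair; linarith

lemma layerPair_symm {t u : ℕ} (h : t + u = n) : layerPair 𝓕 t = layerPair 𝓕 u := by
  unfold layerPair
  rw [show n - t = u by omega, show n - u = t by omega, add_comm]

lemma layerPair_eq {t u : ℕ} (h : t + u = n) :
    layerPair 𝓕 t = density 𝓕 t + density 𝓕 u := by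
  rw [layerPair, show n - t = u by omega]

lemma PartitionFree.layerPair_three_parts (h : PartitionFree 𝓕) {a b c : ℕ}
    (hn : a + b + c = n) : layerPair 𝓕 a + layerPair 𝓕 b + layerPair 𝓕 c ≤ 4 := by
  have := h.density_three_parts hn
  rw [layerPair_eq (show a + (b + c) = n by omega), layerPair_eq (show b + (a + c) = n by omega),
    layerPair_eq (show c + (a + b) = n by omega)]
  linarith

/-- The condition a + b = n + 1 makes [a, b) invariant under t ↦ n - t, so the first sum counts each
middle layer twice; the lower layers are paired with those from b on and need the explicit factor 2.
-/
lemma two_mul_card_eq (𝓕 : Finset (Finset (Fin n))) {a b : ℕ} (hab : a + b = n + 1)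
    (hle : a ≤ b) :
    2 * (#𝓕 : ℚ) = ∑ t ∈ Ico a b, n.choose t * layerPair 𝓕 t +
      2 * ∑ t ∈ range a, n.choose t * layerPair 𝓕 t := by
  have hrefl : ∀ s : Finset ℕ, ∀ s' : Finset ℕ, (∀ t ∈ s, t ≤ n ∧ n - t ∈ s') →
      (∀ t ∈ s', t ≤ n ∧ n - t ∈ s) → ∑ t ∈ s, n.choose t * density 𝓕 (n - t) =
        ∑ t ∈ s', n.choose t * density 𝓕 t := fun s s' h1 h2 => by
    refine sum_nbij' (fun t => n - t) (fun t => n - t) (fun t ht => (h1 t ht).2)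
      (fun t ht => (h2 t ht).2) (fun t ht => Nat.sub_sub_self (h1 t ht).1)
      (fun t ht => Nat.sub_sub_self (h2 t ht).1) (fun t ht => ?_)
    rw [Nat.choose_symm (h1 t ht).1]
  have e1 : (#𝓕 : ℚ) = ∑ t ∈ range a, n.choose t * density 𝓕 t +
      ∑ t ∈ Ico a b, n.choose t * density 𝓕 t +
      ∑ t ∈ Ico b (n + 1), n.choose t * density 𝓕 t := by
    rw [card_eq_sum_choose_mul_density, range_eq_Ico, range_eq_Ico,
      sum_Ico_consecutive _ (by omega) hle, sum_Ico_consecutive _ (by omega) (by omega)]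
  have e2 := hrefl (range a) (Ico b (n + 1))
    (fun t ht => by simp only [mem_range] at ht; simp only [mem_Ico]; omega)
    (fun t ht => by simp only [mem_Ico] at ht; simp only [mem_range]; omega)
  have e3 := hrefl (Ico a b) (Ico a b)
    (fun t ht => by simp only [mem_Ico] at ht ⊢; omega)
    (fun t ht => by simp only [mem_Ico] at ht ⊢; omega)
  simp only [layerPair, mul_add, sum_add_distrib]
  rw [e2, e3, e1]
  ring

lemma two_mul_sum_sub_two_mul_card (𝓕 : Finset (Finset (Fin n))) {a b : ℕ}
    (hab : a + b = n + 1) (hle : a ≤ b) :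
    2 * (∑ t ∈ Ico a b, n.choose t : ℚ) - 2 * #𝓕 =
      ∑ t ∈ Ico a b, n.choose t * (2 - layerPair 𝓕 t) -
        2 * ∑ t ∈ range a, n.choose t * layerPair 𝓕 t := by
  rw [two_mul_card_eq 𝓕 hab hle]
  simp only [mul_sub, sum_sub_distrib, mul_sum]
  simp only [mul_comm _ (2 : ℚ)]
  ring

lemma sum_Ico_symm_split (f : ℕ → ℚ) {a b : ℕ} (hab : a + 1 < b) (hf : f a = f b) :
    ∑ t ∈ Ico a (b + 1), f t = 2 * f a + ∑ t ∈ Ico (a + 1) b, f t := by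
  rw [sum_Ico_succ_top (by omega), sum_eq_sum_Ico_succ_bot (by omega), hf]
  ring

lemma choose_mul_sub_layerPair_symm {t u : ℕ} (h : t + u = n) :
    (n.choose t : ℚ) * (2 - layerPair 𝓕 t) = n.choose u * (2 - layerPair 𝓕 u) := by
  rw [layerPair_symm h, ← Nat.choose_symm (show t ≤ n by omega), show n - t = u by omega]

/-- The part of the two bottom estimates that is charged to the layers `N - t`. -/
lemma sum_choose_mul_le (D : ℕ → ℚ) (hD : ∀ t, 0 ≤ D t) {l N : ℕ} (hl : l ≤ N + 1)
    (h : ∀ t < l, 8 * n.choose t ≤ n.choose (N - t)) :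
    8 * ∑ t ∈ range l, n.choose t * D (N - t) ≤
      ∑ u ∈ Ico (N + 1 - l) (N + 1), n.choose u * D u := by
  calc 8 * ∑ t ∈ range l, n.choose t * D (N - t)
      ≤ ∑ t ∈ range l, n.choose (N - t) * D (N - t) := by
        rw [mul_sum]
        refine sum_le_sum fun t ht => ?_
        have : (8 * n.choose t : ℚ) ≤ n.choose (N - t) := by
          exact_mod_cast h t (mem_range.1 ht)
        rw [← mul_assoc]
        exact mul_le_mul_of_nonneg_right this (hD _)
    _ = ∑ u ∈ Ico (N + 1 - l) (N + 1), n.choose u * D u := by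
        refine sum_nbij' (fun t => N - t) (fun t => N - t) (fun t ht => ?_) (fun t ht => ?_)
          (fun t ht => ?_) (fun t ht => ?_) (fun t _ => rfl)
        · rw [mem_range] at ht; rw [mem_Ico]; omega
        · rw [mem_Ico] at ht; rw [mem_range]; omega
        · rw [mem_range] at ht; exact Nat.sub_sub_self (by omega)
        · rw [mem_Ico] at ht; exact Nat.sub_sub_self (by omega)

/-- The deficiency of a partition-free family on `3m + 2` points. -/
lemma PartitionFree.deficiency_two (h : PartitionFree 𝓕) {k : ℕ} (hn : n = 3 * k + 5)
    (hk : 5 ≤ k) :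
    (n.choose (k + 1) - 2 * n.choose k) * layerPair 𝓕 k +
      (1 / 8) * ∑ u ∈ Ico (k + 3) (2 * k + 3), n.choose u * (2 - layerPair 𝓕 u) ≤
    2 * (∑ t ∈ Ico (k + 2) (2 * k + 4), n.choose t : ℚ) - 2 * #𝓕 := by
  set D : ℕ → ℚ := fun t => 2 - layerPair 𝓕 t with hDdef
  have hD : ∀ t, 0 ≤ D t := fun t => by have := layerPair_le_two 𝓕 t; simp only [D]; linarith
  have hh := layerPair_nonneg 𝓕
  set M : ℚ := ∑ u ∈ Ico (k + 3) (2 * k + 3), n.choose u * D u with hM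
  have hcard := two_mul_sum_sub_two_mul_card 𝓕 (a := k + 2) (b := 2 * k + 4) (by omega) (by omega)
  have hsplit : ∑ t ∈ Ico (k + 2) (2 * k + 4), n.choose t * D t =
      2 * (n.choose (k + 2) * D (k + 2)) + M :=
    sum_Ico_symm_split (fun t => n.choose t * D t) (by omega)
      (choose_mul_sub_layerPair_symm (by omega))
  have hMlow : 2 * (n.choose (k + 3) * D (k + 3)) ≤ M := by
    rw [hM, sum_Ico_symm_split (fun t => n.choose t * D t) (by omega)
      (choose_mul_sub_layerPair_symm (by omega))]
    exact le_add_of_nonneg_right (sum_nonneg fun u _ => mul_nonneg (by positivity) (hD u))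
  -- Parts of sizes t, k + 3, 2k + 2 - t give L(t) ≤ D(k+3) + D(2k+2-t). The second deficit lives in
  -- a layer at least eight times as large as layer t.
  have hlow : ∑ t ∈ range k, n.choose t * layerPair 𝓕 t ≤
      (∑ t ∈ range k, n.choose t : ℚ) * D (k + 3) + (1 / 8) * M := by
    have h1 : ∀ t ∈ range k, (n.choose t : ℚ) * layerPair 𝓕 t ≤
        n.choose t * D (k + 3) + n.choose t * D (2 * k + 2 - t) := fun t ht => by
      have ht := mem_range.1 ht
      have := h.layerPair_three_parts (a := t) (b := k + 3) (c := 2 * k + 2 - t) (by omega)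
      rw [← mul_add]
      refine mul_le_mul_of_nonneg_left ?_ (by positivity)
      simp only [D]; linarith
    have h2 := sum_choose_mul_le (n := n) D hD (l := k) (N := 2 * k + 2) (by omega)
      (fun t ht => eight_mul_choose_le (by omega) (by omega) (by omega))
    rw [show 2 * k + 2 + 1 - k = k + 3 by omega] at h2
    refine (sum_le_sum h1).trans ?_
    rw [sum_add_distrib, ← sum_mul]
    linarith
  have hS : (∑ t ∈ range k, n.choose t : ℚ) ≤ n.choose k := by
    exact_mod_cast sum_range_choose_le (n := n) (k := k) (by omega)
  have hmain := h.density_five_blocks hn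
  rw [← layerPair_eq (show k + 1 + (2 * k + 4) = n by omega),
    ← layerPair_eq (show k + (2 * k + 5) = n by omega),
    ← layerPair_eq (show k + 2 + (2 * k + 3) = n by omega),
    ← layerPair_eq (show k + 3 + (2 * k + 2) = n by omega)] at hmain
  have c1 : (2 * n.choose k : ℚ) ≤ n.choose (k + 1) := by
    exact_mod_cast two_mul_choose_le_choose_succ (n := n) (k := k) (by omega)
  have c2 : (n.choose (k + 2) : ℚ) = 2 * n.choose (k + 1) := by
    exact_mod_cast choose_succ_eq_two_mul_choose (n := n) (k := k + 1) (by omega)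
  -- The ratio is (2k + 3)/(k + 3), which reaches 8/5 only from k = 5 on, that is, m ≥ 6.
  have c3 : (8 * n.choose (k + 2) : ℚ) ≤ 5 * n.choose (k + 3) := by
    have := Nat.choose_succ_right_eq n (k + 2)
    rw [show n - (k + 2) = 2 * k + 3 by omega] at this
    have : (8 * n.choose (k + 2)) * (k + 3) ≤ (5 * n.choose (k + 3)) * (k + 3) := by
      rw [mul_assoc 5, show n.choose (k + 3) * (k + 3) = _ from this]
      nlinarith [Nat.zero_le (n.choose (k + 2))]
    exact_mod_cast Nat.le_of_mul_le_mul_right this (by omega)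
  rw [hcard, hsplit, sum_range_succ, sum_range_succ]
  -- Of the middle sum M, a quarter goes to the layers below k. The charges to D(k+3) total at most
  -- 4C(n,k+1) = 2C(n,k+2), which by `c3` and `hMlow` costs at most 5M/8, so M/8 remains.
  have m1 := mul_le_mul_of_nonneg_left hmain (show (0 : ℚ) ≤ n.choose (k + 1) by positivity)
  have m2 := mul_le_mul_of_nonneg_right c3 (hD (k + 3))
  have m3 := mul_le_mul_of_nonneg_right hS (hD (k + 3))
  have m4 := mul_le_mul_of_nonneg_right c1 (hD (k + 3))
  rw [c2] at m2 ⊢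
  have e1 : layerPair 𝓕 (k + 2) = 2 - D (k + 2) := by simp only [D]; ring
  have e2 : layerPair 𝓕 (k + 3) = 2 - D (k + 3) := by simp only [D]; ring
  rw [e1, e2] at m1
  linarith

end

/-! ### The deficiency for n = 3m -/

section

variable {n : ℕ} {𝓕 : Finset (Finset (Fin n))}

/-- All coefficients are written as rational multiples of C(n,k+1), where m = k + 2. The first
relation is C(n,m)/C(n,m-1) = 2 + 1/m; the others are the margins needed in the deficiency estimate.
-/
lemma choose_estimates {k : ℕ} (hk : 4 ≤ k) (hn : n = 3 * k + 6) :
    ((k + 2) * n.choose (k + 2) : ℚ) = (2 * k + 5) * n.choose (k + 1) ∧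
    (2 * n.choose k : ℚ) < n.choose (k + 1) ∧
    (7 * n.choose (k + 1) + 2 * n.choose (k - 1) : ℚ) < 2 * n.choose (k + 3) ∧
    (24 * n.choose (k + 1) : ℚ) ≤ 5 * n.choose (k + 4) := by
  obtain ⟨j, rfl⟩ : ∃ j, k = j + 1 := ⟨k - 1, by omega⟩
  simp only [Nat.add_sub_cancel]
  have e1 := Nat.choose_succ_right_eq n j
  have e2 := Nat.choose_succ_right_eq n (j + 1)
  have e3 := Nat.choose_succ_right_eq n (j + 2)
  have e4 := Nat.choose_succ_right_eq n (j + 3)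
  have e5 := Nat.choose_succ_right_eq n (j + 4)
  rw [show n - j = 2 * j + 9 by omega] at e1
  rw [show n - (j + 1) = 2 * j + 8 by omega] at e2
  rw [show n - (j + 2) = 2 * j + 7 by omega] at e3
  rw [show n - (j + 3) = 2 * j + 6 by omega] at e4
  rw [show n - (j + 4) = 2 * j + 5 by omega] at e5
  simp only [add_assoc, Nat.reduceAdd] at *
  have hpos : (0 : ℚ) < n.choose (j + 2) := by
    exact_mod_cast Nat.choose_pos (by omega)
  have hj : (3 : ℚ) ≤ j := by exact_mod_cast (show 3 ≤ j by omega)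
  rify at e1 e2 e3 e4 e5
  replace e1 : (n.choose (j + 1) : ℚ) * (j + 1) = n.choose j * (2 * j + 9) := by exact_mod_cast e1
  replace e2 : (n.choose (j + 2) : ℚ) * (j + 2) = n.choose (j + 1) * (2 * j + 8) := by
    exact_mod_cast e2
  replace e3 : (n.choose (j + 3) : ℚ) * (j + 3) = n.choose (j + 2) * (2 * j + 7) := by
    exact_mod_cast e3
  replace e4 : (n.choose (j + 4) : ℚ) * (j + 4) = n.choose (j + 3) * (2 * j + 6) := by
    exact_mod_cast e4
  replace e5 : (n.choose (j + 5) : ℚ) * (j + 5) = n.choose (j + 4) * (2 * j + 5) := by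
    exact_mod_cast e5
  generalize (n.choose (j + 2) : ℚ) = c at *
  have f1 : (n.choose (j + 1) : ℚ) = c * (j + 2) / (2 * j + 8) := by field_simp; linarith
  have f0 : (n.choose j : ℚ) = c * (j + 2) / (2 * j + 8) * (j + 1) / (2 * j + 9) := by
    rw [← f1]; field_simp; linarith
  have f3 : (n.choose (j + 3) : ℚ) = c * (2 * j + 7) / (j + 3) := by field_simp; linarith
  have f4 : (n.choose (j + 4) : ℚ) = c * (2 * j + 7) * 2 / (j + 4) := by
    have : c * (2 * j + 7) / (j + 3) * (2 * j + 6) = c * (2 * j + 7) * 2 := by field_simp; ring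
    rw [eq_div_iff (by positivity), e4, f3, this]
  have f5 : (n.choose (j + 5) : ℚ) = c * (2 * j + 7) * 2 / (j + 4) * (2 * j + 5) / (j + 5) := by
    rw [← f4]; field_simp; linarith
  refine ⟨?_, ?_, ?_, ?_⟩
  · push_cast; linarith
  · rw [f1, ← sub_pos]
    have : c - 2 * (c * (j + 2) / (2 * j + 8)) = c * (4 / (2 * j + 8)) := by field_simp; ring
    rw [this]; positivity
  · rw [f0, f4, ← sub_pos]
    have : 2 * (c * (2 * j + 7) * 2 / (j + 4)) -
        (7 * c + 2 * (c * (j + 2) / (2 * j + 8) * (j + 1) / (2 * j + 9))) =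
        c * ((j ^ 2 + 6 * j - 2) / ((j + 4) * (2 * j + 9))) := by field_simp; ring
    rw [this]
    have : (0 : ℚ) < j ^ 2 + 6 * j - 2 := by nlinarith
    positivity
  · rw [f5, ← sub_nonneg]
    have : 5 * (c * (2 * j + 7) * 2 / (j + 4) * (2 * j + 5) / (j + 5)) - 24 * c =
        c * ((16 * j ^ 2 + 24 * j - 130) / ((j + 4) * (j + 5))) := by field_simp; ring
    rw [this]
    -- Negative at j = 2: this estimate needs j ≥ 3, which is m ≥ 6.
    have : (0 : ℚ) ≤ 16 * j ^ 2 + 24 * j - 130 := by nlinarith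
    positivity

/-- The deficiency of a partition-free family on `3m` points. -/
lemma PartitionFree.deficiency_zero (h : PartitionFree 𝓕) {k : ℕ} (hn : n = 3 * k + 6)
    (hk : 4 ≤ k) {β : ℚ} (hβ : density 𝓕 (k + 2) + density 𝓕 (2 * k + 4) - 1 ≤ (k + 2) * β) :
    n.choose (k + 1) * (25 - (2 * β +
        4 * density 𝓕 (k + 2) + 2 * density 𝓕 (k + 1) + (density 𝓕 k + density 𝓕 (2 * k + 6)) +
        2 * density 𝓕 (2 * k + 5) + 4 * density 𝓕 (2 * k + 4) +
        7 * density 𝓕 (k + 3) + 4 * density 𝓕 (2 * k + 3) +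
        5 * density 𝓕 (k + 4) + 3 * density 𝓕 (2 * k + 2))) +
      (2 * n.choose (k + 3) - (7 * n.choose (k + 1) + 2 * n.choose (k - 1))) *
        (2 - layerPair 𝓕 (k + 3)) +
      (n.choose (k + 1) - 2 * n.choose k) * layerPair 𝓕 k +
      (1 / 8) * ∑ u ∈ Ico (k + 4) (2 * k + 3), n.choose u * (2 - layerPair 𝓕 u) ≤
    2 * ((∑ t ∈ Ico (k + 3) (2 * k + 4), n.choose t : ℚ) + n.choose (k + 2) + n.choose (k + 1)) -
      2 * #𝓕 := by
  obtain ⟨c1, c2, c3, c4⟩ := choose_estimates hk hn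
  set D : ℕ → ℚ := fun t => 2 - layerPair 𝓕 t with hDdef
  have hD : ∀ t, 0 ≤ D t := fun t => by have := layerPair_le_two 𝓕 t; simp only [D]; linarith
  have hh := layerPair_nonneg 𝓕
  set M : ℚ := ∑ u ∈ Ico (k + 4) (2 * k + 3), n.choose u * D u with hM
  have hcard := two_mul_sum_sub_two_mul_card 𝓕 (a := k + 3) (b := 2 * k + 4) (by omega) (by omega)
  have hsplit : ∑ t ∈ Ico (k + 3) (2 * k + 4), n.choose t * D t =
      2 * (n.choose (k + 3) * D (k + 3)) + M :=
    sum_Ico_symm_split (fun t => n.choose t * D t) (by omega)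
      (choose_mul_sub_layerPair_symm (by omega))
  have hMlow : 2 * (n.choose (k + 4) * D (k + 4)) ≤ M := by
    rw [hM, sum_Ico_symm_split (fun t => n.choose t * D t) (by omega)
      (choose_mul_sub_layerPair_symm (by omega))]
    exact le_add_of_nonneg_right (sum_nonneg fun u _ => mul_nonneg (by positivity) (hD u))
  have hlow : ∑ t ∈ range (k - 1), n.choose t * layerPair 𝓕 t ≤
      (∑ t ∈ range (k - 1), n.choose t : ℚ) * D (k + 4) + (1 / 8) * M := by
    have h1 : ∀ t ∈ range (k - 1), (n.choose t : ℚ) * layerPair 𝓕 t ≤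
        n.choose t * D (k + 4) + n.choose t * D (2 * k + 2 - t) := fun t ht => by
      have ht := mem_range.1 ht
      have := h.layerPair_three_parts (a := t) (b := k + 4) (c := 2 * k + 2 - t) (by omega)
      rw [← mul_add]
      refine mul_le_mul_of_nonneg_left ?_ (by positivity)
      simp only [D]; linarith
    have h2 := sum_choose_mul_le (n := n) D hD (l := k - 1) (N := 2 * k + 2) (by omega)
      (fun t ht => eight_mul_choose_le (by omega) (by omega) (by omega))
    rw [show 2 * k + 2 + 1 - (k - 1) = k + 4 by omega] at h2
    refine (sum_le_sum h1).trans ?_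
    rw [sum_add_distrib, ← sum_mul]
    linarith
  have hS : (∑ t ∈ range (k - 1), n.choose t : ℚ) ≤ n.choose (k - 1) := by
    exact_mod_cast sum_range_choose_le (n := n) (k := k - 1) (by omega)
  -- Layer k - 1 is charged separately, because its partner layer k + 3 lies just outside the sum M.
  have hthree := h.layerPair_three_parts (a := k - 1) (b := k + 3) (c := k + 4) (by omega)
  have c5 : (2 * n.choose (k - 1) : ℚ) ≤ n.choose k := by
    have := two_mul_choose_le_choose_succ (n := n) (k := k - 1) (by omega)
    rw [show k - 1 + 1 = k by omega] at this
    exact_mod_cast this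
  -- The excess C(n,m) - 2C(n,m-1) = C(n,m-1)/m is exactly what the exchange bound `hβ` pays for.
  have hx : 2 * n.choose (k + 2) * (density 𝓕 (k + 2) + density 𝓕 (2 * k + 4) - 1) ≤
      4 * n.choose (k + 1) * (density 𝓕 (k + 2) + density 𝓕 (2 * k + 4) - 1) +
        2 * n.choose (k + 1) * β := by
    have hk0 : (0 : ℚ) < k + 2 := by positivity
    refine le_of_mul_le_mul_left ?_ hk0
    have := mul_le_mul_of_nonneg_left hβ (show (0 : ℚ) ≤ 2 * n.choose (k + 1) by positivity)
    calc (k + 2 : ℚ) * (2 * n.choose (k + 2) *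
          (density 𝓕 (k + 2) + density 𝓕 (2 * k + 4) - 1))
        = 2 * ((k + 2) * n.choose (k + 2)) *
          (density 𝓕 (k + 2) + density 𝓕 (2 * k + 4) - 1) := by ring
      _ ≤ _ := by rw [c1]; linarith
  rw [hsplit, sum_range_succ, sum_range_succ, sum_range_succ,
    show range k = range (k - 1 + 1) by rw [show k - 1 + 1 = k by omega], sum_range_succ] at hcard
  have hc : (0 : ℚ) ≤ n.choose (k + 1) := by positivity
  have m1 := mul_le_mul_of_nonneg_left hthree (show (0 : ℚ) ≤ n.choose (k - 1) by positivity)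
  have m2 := mul_le_mul_of_nonneg_right c4 (hD (k + 4))
  have m3 := mul_le_mul_of_nonneg_right hS (hD (k + 4))
  have m4 := mul_le_mul_of_nonneg_right (show (4 * n.choose (k - 1) : ℚ) ≤ n.choose (k + 1) by
    linarith) (hD (k + 4))
  -- The weights 7, 4 and 5, 3 are unequal within a complementary pair; bounding the upper density
  -- by 1 raises them to 7, 7 and 5, 5, so that only pair deficits remain.
  have g1 := mul_nonneg hc (sub_nonneg.2 (density_le_one 𝓕 (2 * k + 3)))
  have g2 := mul_nonneg hc (sub_nonneg.2 (density_le_one 𝓕 (2 * k + 2)))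
  have l0 := layerPair_eq (𝓕 := 𝓕) (show k + 2 + (2 * k + 4) = n by omega)
  have l1 := layerPair_eq (𝓕 := 𝓕) (show k + 1 + (2 * k + 5) = n by omega)
  have l2 := layerPair_eq (𝓕 := 𝓕) (show k + (2 * k + 6) = n by omega)
  have l3 : density 𝓕 (k + 3) = 2 - D (k + 3) - density 𝓕 (2 * k + 3) := by
    simp only [D]; rw [layerPair_eq (show k + 3 + (2 * k + 3) = n by omega)]; ring
  have l4 : density 𝓕 (k + 4) = 2 - D (k + 4) - density 𝓕 (2 * k + 2) := by
    simp only [D]; rw [layerPair_eq (show k + 4 + (2 * k + 2) = n by omega)]; ring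
  have l5 : layerPair 𝓕 (k + 3) = 2 - D (k + 3) := by simp only [D]; ring
  have l6 : layerPair 𝓕 (k + 4) = 2 - D (k + 4) := by simp only [D]; ring
  rw [l5, l6] at m1
  rw [l0, l1, l2] at hcard
  rw [l2, l5, l3, l4]
  linarith

end

/-! ### The upper bounds, and the layers decided by equality -/

section

variable {n : ℕ} {𝓕 : Finset (Finset (Fin n))}

lemma sum_Icc_eq_sum_Ico (n m : ℕ) :
    ∑ t ∈ Icc (m + 1) (2 * m + 1), n.choose t = ∑ t ∈ Ico (m + 1) (2 * m + 2), n.choose t := by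
  refine sum_congr ?_ fun _ _ => rfl
  ext t; simp only [mem_Icc, mem_Ico]; omega

lemma sum_choose_mul_sub_layerPair_nonneg (𝓕 : Finset (Finset (Fin n))) (s : Finset ℕ) :
    0 ≤ ∑ u ∈ s, n.choose u * (2 - layerPair 𝓕 u) :=
  sum_nonneg fun u _ => mul_nonneg (by positivity) (sub_nonneg.2 (layerPair_le_two 𝓕 u))

lemma layerPair_eq_two_of_sum_eq_zero {a b : ℕ} (hb : b ≤ n + 1)
    (h : ∑ u ∈ Ico a b, n.choose u * (2 - layerPair 𝓕 u) ≤ 0) {u : ℕ} (hu : u ∈ Ico a b) :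
    layerPair 𝓕 u = 2 := by
  have h0 := (sum_eq_zero_iff_of_nonneg fun u _ => mul_nonneg (by positivity)
    (sub_nonneg.2 (layerPair_le_two 𝓕 u))).1
    (le_antisymm h (sum_choose_mul_sub_layerPair_nonneg 𝓕 _)) u hu
  have : (n.choose u : ℚ) ≠ 0 := by
    have := Nat.choose_pos (show u ≤ n by rw [mem_Ico] at hu; omega)
    positivity
  have := (mul_eq_zero.1 h0).resolve_left this
  linarith

lemma density_eq_one_of_layerPair_eq_two {t : ℕ} (h : layerPair 𝓕 t = 2) : density 𝓕 t = 1 := by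
  have h1 := density_le_one 𝓕 t
  have h2 := density_le_one 𝓕 (n - t)
  unfold layerPair at h; linarith

lemma density_eq_zero_of_layerPair_nonpos {t : ℕ} (h : layerPair 𝓕 t ≤ 0) :
    density 𝓕 t = 0 ∧ density 𝓕 (n - t) = 0 := by
  have h1 := density_nonneg 𝓕 t
  have h2 := density_nonneg 𝓕 (n - t)
  unfold layerPair at h; constructor <;> linarith

lemma PartitionFree.card_le_two (h : PartitionFree 𝓕) {m : ℕ} (hn : n = 3 * m + 2)
    (hm : 6 ≤ m) : #𝓕 ≤ ∑ t ∈ Icc (m + 1) (2 * m + 1), n.choose t := by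
  obtain ⟨k, rfl⟩ : ∃ k, m = k + 1 := ⟨m - 1, by omega⟩
  have h1 := h.deficiency_two (k := k) (by omega) (by omega)
  have h2 := sum_choose_mul_sub_layerPair_nonneg 𝓕 (Ico (k + 3) (2 * k + 3))
  have h3 : (2 * n.choose k : ℚ) ≤ n.choose (k + 1) := by
    exact_mod_cast two_mul_choose_le_choose_succ (n := n) (k := k) (by omega)
  have h4 := mul_nonneg (sub_nonneg.2 h3) (layerPair_nonneg 𝓕 k)
  rw [sum_Icc_eq_sum_Ico, ← Nat.cast_le (α := ℚ)]
  push_cast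
  rw [show k + 1 + 1 = k + 2 from rfl, show 2 * (k + 1) + 2 = 2 * k + 4 by ring]
  linarith

/-- Equality on `3m + 2` points: all layers but four are decided. -/
lemma PartitionFree.eq_two (h : PartitionFree 𝓕) {m : ℕ} (hn : n = 3 * m + 2) (hm : 6 ≤ m)
    (heq : #𝓕 = ∑ t ∈ Icc (m + 1) (2 * m + 1), n.choose t) :
    (∀ t, m + 2 ≤ t → t ≤ 2 * m → density 𝓕 t = 1) ∧
      (∀ t, t < m → density 𝓕 t = 0 ∧ density 𝓕 (n - t) = 0) ∧
      layerPair 𝓕 m = 2 * (2 - layerPair 𝓕 (m + 1)) := by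
  obtain ⟨k, rfl⟩ : ∃ k, m = k + 1 := ⟨m - 1, by omega⟩
  have h1 := h.deficiency_two (k := k) (by omega) (by omega)
  have h2 := sum_choose_mul_sub_layerPair_nonneg 𝓕 (Ico (k + 3) (2 * k + 3))
  have h3 : (2 * n.choose k : ℚ) < n.choose (k + 1) := by
    have e := Nat.choose_succ_right_eq n k
    rw [show n - k = 2 * k + 5 by omega] at e
    have hpos := Nat.choose_pos (show k ≤ n by omega)
    have : (2 * n.choose k) * (k + 1) < n.choose (k + 1) * (k + 1) := by rw [e]; nlinarith
    exact_mod_cast Nat.lt_of_mul_lt_mul_right this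
  have h4 := mul_nonneg (sub_nonneg.2 h3.le) (layerPair_nonneg 𝓕 k)
  rw [sum_Icc_eq_sum_Ico, show k + 1 + 1 = k + 2 from rfl,
    show 2 * (k + 1) + 2 = 2 * k + 4 by ring] at heq
  have heq' : (∑ t ∈ Ico (k + 2) (2 * k + 4), n.choose t : ℚ) = #𝓕 := by
    rw [heq]; push_cast; rfl
  rw [heq', sub_self] at h1
  -- The deficiency is 0 and bounds a sum of nonnegative terms, so each term vanishes.
  have hfull : ∀ t ∈ Ico (k + 3) (2 * k + 3), layerPair 𝓕 t = 2 := fun t ht =>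
    layerPair_eq_two_of_sum_eq_zero (by omega) (by linarith) ht
  have hk : layerPair 𝓕 k ≤ 0 := by
    have : (n.choose (k + 1) - 2 * n.choose k) * layerPair 𝓕 k ≤ 0 := by linarith
    exact nonpos_of_mul_nonpos_right this (sub_pos.2 h3)
  have hlow : ∀ t < k + 1, layerPair 𝓕 t ≤ 0 := fun t ht => by
    rcases Nat.lt_succ_iff_lt_or_eq.1 ht with ht | rfl
    · have := h.layerPair_three_parts (a := t) (b := k + 3) (c := 2 * k + 2 - t) (by omega)
      rw [hfull (k + 3) (mem_Ico.2 (by omega)),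
        hfull (2 * k + 2 - t) (mem_Ico.2 (by omega))] at this
      linarith
    · exact hk
  refine ⟨fun t ht ht' => density_eq_one_of_layerPair_eq_two (hfull t (mem_Ico.2 (by omega))),
    fun t ht => density_eq_zero_of_layerPair_nonpos (hlow t ht), ?_⟩
  -- Put back into the exact counting identity, the decided layers cancel and only the pairs of m
  -- and m + 1 are left.
  have e := two_mul_sum_sub_two_mul_card 𝓕 (a := k + 2) (b := 2 * k + 4) (by omega) (by omega)
  rw [heq', sub_self, sum_Ico_symm_split (fun t => (n.choose t : ℚ) * (2 - layerPair 𝓕 t))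
    (by omega) (choose_mul_sub_layerPair_symm (by omega)), sum_eq_zero (s := Ico _ _) (fun t ht => by
      rw [hfull t ht]; ring), sum_range_succ, sum_eq_zero (s := range _) (fun t ht => by
      have := hlow t (mem_range.1 ht)
      rw [le_antisymm this (layerPair_nonneg 𝓕 t), mul_zero]),
    show (n.choose (k + 2) : ℚ) = 2 * n.choose (k + 1) by
      exact_mod_cast choose_succ_eq_two_mul_choose (n := n) (k := k + 1) (by omega)] at e
  have hc : (n.choose (k + 1) : ℚ) ≠ 0 := by
    have := Nat.choose_pos (show k + 1 ≤ n by omega)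
    positivity
  have : (n.choose (k + 1) : ℚ) * (layerPair 𝓕 (k + 1) - 2 * (2 - layerPair 𝓕 (k + 2))) = 0 := by
    linarith
  have := (mul_eq_zero.1 this).resolve_left hc
  rw [show k + 1 + 1 = k + 2 from rfl]
  linarith

/-- The probability that a random exchange of one element leaves the family. -/
def exchangeAverage (𝓕 : Finset (Finset (Fin n))) (X X' : Finset (Fin n)) : ℚ :=
  permAverage n (fun σ => (indicatorOf 𝓕 (X.map (σ.symm : Fin n ↪ Fin n)) : ℚ) *
    (1 - (indicatorOf 𝓕 (X'.map (σ.symm : Fin n ↪ Fin n)) : ℚ)))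

lemma PartitionFree.density_six_blocks_exchange (h : PartitionFree 𝓕) {k : ℕ}
    (hn : n = 3 * k + 6) {X X' : Finset (Fin n)} (hX : #X = k + 2) (hX' : #X' = k + 2)
    (hXX' : #(X ∩ X') = k + 1) :
    2 * exchangeAverage 𝓕 X X' +
      4 * density 𝓕 (k + 2) + 2 * density 𝓕 (k + 1) + (density 𝓕 k + density 𝓕 (2 * k + 6)) +
      2 * density 𝓕 (2 * k + 5) + 4 * density 𝓕 (2 * k + 4) +
      7 * density 𝓕 (k + 3) + 4 * density 𝓕 (2 * k + 3) +
      5 * density 𝓕 (k + 4) + 3 * density 𝓕 (2 * k + 2) ≤ 25 := by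
  obtain ⟨c, hc⟩ := exists_coloring (n := n) ![k, 1, 1, k + 1, 1, k + 2]
    (by simp [Fin.sum_univ_succ]; omega)
  have hcard : ∀ J, #(blockSet c J) = ∑ j ∈ J, (![k, 1, 1, k + 1, 1, k + 2] : Fin 6 → ℕ) j :=
    fun J => by rw [card_blockSet, sum_congr rfl fun j _ => hc j]
  have := h.density_six_blocks hc
  rwa [show permAverage n (blockIndicator 𝓕 c {3, 4} * (1 - blockIndicator 𝓕 c {2, 3})) =
    exchangeAverage 𝓕 X X' from ?_] at this
  have e : blockIndicator 𝓕 c {3, 4} * (1 - blockIndicator 𝓕 c {2, 3}) = fun σ =>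
      (indicatorOf 𝓕 ((blockSet c {3, 4}).map (σ.symm : Fin n ↪ Fin n)) : ℚ) *
        (1 - (indicatorOf 𝓕 ((blockSet c {2, 3}).map (σ.symm : Fin n ↪ Fin n)) : ℚ)) := by
    funext σ
    simp only [Pi.mul_apply, Pi.sub_apply, Pi.one_apply, blockIndicator, blockSet_comp]
  rw [e]
  refine permAverage_pair_eq ?_ ?_ ?_
    (fun A B => (indicatorOf 𝓕 A : ℚ) * (1 - (indicatorOf 𝓕 B : ℚ)))
  · rw [hcard, hX]; simp
  · rw [hcard, hX']; simp; omega
  · rw [← blockSet_inter, hcard, hXX', show ({3, 4} ∩ {2, 3} : Finset (Fin 6)) = {3} by decide]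
    simp

lemma exists_exchange_pair {m : ℕ} (hm : 1 ≤ m) (hn : m + 1 ≤ n) :
    ∃ X X' : Finset (Fin n), #X = m ∧ #X' = m ∧ #(X ∩ X') + 1 = m := by
  refine ⟨finSegment n 0 m, finSegment n 1 (m + 1), ?_, ?_, ?_⟩
  · rw [card_finSegment (by omega)]; omega
  · rw [card_finSegment (by omega)]; omega
  · rw [show finSegment n 0 m ∩ finSegment n 1 (m + 1) = finSegment n 1 m by
      ext i; simp [finSegment]; omega, card_finSegment (by omega)]
    omega

/-- For n = 3m the interval [m + 1, 2m + 1] is not self-complementary: the layers 2m and 2m + 1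
stick out and are counted through their complements m and m - 1. -/
lemma sum_Icc_choose_eq {k : ℕ} (hn : n = 3 * k + 6) :
    (∑ t ∈ Icc (k + 2 + 1) (2 * (k + 2) + 1), n.choose t : ℚ) =
      (∑ t ∈ Ico (k + 3) (2 * k + 4), n.choose t : ℚ) + n.choose (k + 2) + n.choose (k + 1) := by
  rw [← Nat.choose_symm (show k + 2 ≤ n by omega), ← Nat.choose_symm (show k + 1 ≤ n by omega),
    show n - (k + 2) = 2 * k + 4 by omega, show n - (k + 1) = 2 * k + 5 by omega,
    ← sum_Ico_succ_top (by omega), ← sum_Ico_succ_top (by omega)]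
  refine sum_congr ?_ fun _ _ => rfl
  ext t; simp only [mem_Icc, mem_Ico]; omega

lemma PartitionFree.card_le_zero (h : PartitionFree 𝓕) {m : ℕ} (hn : n = 3 * m)
    (hm : 6 ≤ m) : #𝓕 ≤ ∑ t ∈ Icc (m + 1) (2 * m + 1), n.choose t := by
  obtain ⟨k, rfl⟩ : ∃ k, m = k + 2 := ⟨m - 2, by omega⟩
  obtain ⟨X, X', hX, hX', hXX'⟩ := exists_exchange_pair (n := n) (m := k + 2) (by omega) (by omega)
  have h0 := h.mul_permAverage_exchange (m := k + 2) (by omega) hX hX' hXX'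
  have h6 := h.density_six_blocks_exchange (k := k) (by omega) hX hX' (by omega)
  have h1 := h.deficiency_zero (k := k) (by omega) (by omega) (β := exchangeAverage 𝓕 X X')
    (by rw [show 2 * k + 4 = 2 * (k + 2) by ring]; push_cast at h0; exact h0)
  obtain ⟨-, c2, c3, -⟩ := choose_estimates (n := n) (k := k) (by omega) (by omega)
  have h2 := sum_choose_mul_sub_layerPair_nonneg 𝓕 (Ico (k + 4) (2 * k + 3))
  have h3 := mul_nonneg (sub_nonneg.2 c2.le) (layerPair_nonneg 𝓕 k)
  have h4 := mul_nonneg (sub_nonneg.2 c3.le) (sub_nonneg.2 (layerPair_le_two 𝓕 (k + 3)))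
  have h5 := mul_nonneg (show (0 : ℚ) ≤ n.choose (k + 1) by positivity) (sub_nonneg.2 h6)
  rw [← sum_Icc_choose_eq (by omega)] at h1
  rw [← Nat.cast_le (α := ℚ)]
  push_cast
  linarith

/-- Equality on `3m` points: all layers but four are decided. -/
lemma PartitionFree.eq_zero (h : PartitionFree 𝓕) {m : ℕ} (hn : n = 3 * m) (hm : 6 ≤ m)
    (heq : #𝓕 = ∑ t ∈ Icc (m + 1) (2 * m + 1), n.choose t) :
    (∀ t, m + 1 ≤ t → t ≤ 2 * m - 1 → density 𝓕 t = 1) ∧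
      (∀ t, t + 2 ≤ m → density 𝓕 t = 0 ∧ density 𝓕 (n - t) = 0) ∧
      ∀ X X' : Finset (Fin n), #X = m → #X' = m → #(X ∩ X') + 1 = m →
        exchangeAverage 𝓕 X X' + 2 * density 𝓕 m + density 𝓕 (m - 1) + 2 * density 𝓕 (2 * m) +
          density 𝓕 (2 * m + 1) = 3 := by
  obtain ⟨k, rfl⟩ : ∃ k, m = k + 2 := ⟨m - 2, by omega⟩
  obtain ⟨-, c2, c3, -⟩ := choose_estimates (n := n) (k := k) (by omega) (by omega)
  have heq' : (∑ t ∈ Icc (k + 2 + 1) (2 * (k + 2) + 1), n.choose t : ℚ) = #𝓕 := by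
    rw [heq]; push_cast; rfl
  rw [sum_Icc_choose_eq (by omega)] at heq'
  have h2 := sum_choose_mul_sub_layerPair_nonneg 𝓕 (Ico (k + 4) (2 * k + 3))
  have h3 := mul_nonneg (sub_nonneg.2 c2.le) (layerPair_nonneg 𝓕 k)
  have h4 := mul_nonneg (sub_nonneg.2 c3.le) (sub_nonneg.2 (layerPair_le_two 𝓕 (k + 3)))
  have hc : (0 : ℚ) < n.choose (k + 1) := by
    have := Nat.choose_pos (show k + 1 ≤ n by omega)
    positivity
  have key : ∀ X X' : Finset (Fin n), #X = k + 2 → #X' = k + 2 → #(X ∩ X') + 1 = k + 2 → _ :=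
    fun X X' hX hX' hXX' => by
      have h0 := h.mul_permAverage_exchange (m := k + 2) (by omega) hX hX' hXX'
      have h1 := h.deficiency_zero (k := k) (by omega) (by omega) (β := exchangeAverage 𝓕 X X')
        (by rw [show 2 * k + 4 = 2 * (k + 2) by ring]; push_cast at h0; exact h0)
      rw [heq', sub_self] at h1
      exact h1
  have key6 := fun X X' hX hX' (hXX' : #(X ∩ X') + 1 = k + 2) =>
    h.density_six_blocks_exchange (k := k) (X := X) (X' := X') (by omega) hX hX' (by omega)
  obtain ⟨X, X', hX, hX', hXX'⟩ := exists_exchange_pair (n := n) (m := k + 2) (by omega) (by omega)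
  have h1 := key X X' hX hX' hXX'
  have h5 := mul_nonneg hc.le (sub_nonneg.2 (key6 X X' hX hX' hXX'))
  have hfull' : ∀ t ∈ Ico (k + 4) (2 * k + 3), layerPair 𝓕 t = 2 := fun t ht =>
    layerPair_eq_two_of_sum_eq_zero (by omega) (by linarith) ht
  have hk3 : layerPair 𝓕 (k + 3) = 2 := by
    have : (2 * n.choose (k + 3) - (7 * n.choose (k + 1) + 2 * n.choose (k - 1))) *
        (2 - layerPair 𝓕 (k + 3)) ≤ 0 := by linarith
    have := nonpos_of_mul_nonpos_right this (sub_pos.2 c3)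
    linarith [layerPair_le_two 𝓕 (k + 3)]
  have hfull : ∀ t, k + 3 ≤ t → t ≤ 2 * k + 3 → layerPair 𝓕 t = 2 := fun t ht ht' => by
    by_cases e1 : t = k + 3
    · rw [e1, hk3]
    by_cases e2 : t = 2 * k + 3
    · rw [e2, layerPair_symm (show 2 * k + 3 + (k + 3) = n by omega), hk3]
    · exact hfull' t (mem_Ico.2 (by omega))
  have hone : ∀ t, k + 3 ≤ t → t ≤ 2 * k + 3 → density 𝓕 t = 1 := fun t ht ht' =>
    density_eq_one_of_layerPair_eq_two (hfull t ht ht')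
  have hk : layerPair 𝓕 k ≤ 0 := by
    have : (n.choose (k + 1) - 2 * n.choose k) * layerPair 𝓕 k ≤ 0 := by linarith
    exact nonpos_of_mul_nonpos_right this (sub_pos.2 c2)
  have hlow : ∀ t, t ≤ k → layerPair 𝓕 t ≤ 0 := fun t ht => by
    by_cases e : t = k
    · rw [e]; exact hk
    · have := h.layerPair_three_parts (a := t) (b := k + 3) (c := 2 * k + 3 - t) (by omega)
      rw [hk3, hfull (2 * k + 3 - t) (by omega) (by omega)] at this
      linarith
  refine ⟨fun t ht ht' => hone t (by omega) (by omega),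
    fun t ht => density_eq_zero_of_layerPair_nonpos (hlow t (by omega)), ?_⟩
  intro Y Y' hY hY' hYY'
  have g1 := key Y Y' hY hY' hYY'
  have g6 := key6 Y Y' hY hY' hYY'
  have z0 := density_eq_zero_of_layerPair_nonpos (hlow k le_rfl)
  rw [show n - k = 2 * k + 6 by omega] at z0
  rw [z0.1, z0.2, hone (k + 3) (by omega) (by omega), hone (2 * k + 3) (by omega) (by omega),
    hone (k + 4) (by omega) (by omega), hone (2 * k + 2) (by omega) (by omega)] at g1 g6
  rw [show k + 2 - 1 = k + 1 by omega, show 2 * (k + 2) = 2 * k + 4 by ring]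
  -- With the decided densities inserted, all that is left of the deficiency bound is the slack of
  -- the six-block inequality, which must vanish for every exchange pair.
  have : (n.choose (k + 1) : ℚ) * (25 - (2 * exchangeAverage 𝓕 Y Y' +
        4 * density 𝓕 (k + 2) + 2 * density 𝓕 (k + 1) + (0 + 0) +
        2 * density 𝓕 (2 * k + 5) + 4 * density 𝓕 (2 * k + 4) +
        7 * 1 + 4 * 1 + 5 * 1 + 3 * 1)) ≤ 0 := by linarith
  have := nonpos_of_mul_nonpos_right this hc
  linarith

end

/-! ### Exchange paths, Kneser connectivity and pointwise tightness -/

section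

variable {n : ℕ} {𝓕 : Finset (Finset (Fin n))}

/-- Between a set with property `P` and an equally large set without it there is an exchange of
one element at which `P` is lost. -/
lemma exists_exchange (P : Finset (Fin n) → Prop) {Y Y' : Finset (Fin n)} (hc : #Y = #Y')
    (hY : P Y) (hY' : ¬ P Y') :
    ∃ S a b, a ∉ S ∧ b ∉ S ∧ a ≠ b ∧ #S + 1 = #Y ∧ insert a S ⊆ Y ∪ Y' ∧ insert b S ⊆ Y ∪ Y' ∧
      P (insert a S) ∧ ¬ P (insert b S) := by
  induction hk : #(Y' \ Y) generalizing Y with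
  | zero =>
    rw [card_eq_zero, sdiff_eq_empty_iff_subset] at hk
    exact absurd (eq_of_subset_of_card_le hk hc.le ▸ hY) hY'
  | succ k ih =>
    obtain ⟨b, hb⟩ : (Y' \ Y).Nonempty := card_pos.1 (by omega)
    have hk' : #(Y \ Y') = k + 1 := by
      have := card_sdiff_add_card_inter Y Y'
      have := card_sdiff_add_card_inter Y' Y
      rw [inter_comm] at this
      omega
    obtain ⟨a, ha⟩ : (Y \ Y').Nonempty := card_pos.1 (by omega)
    rw [mem_sdiff] at ha hb
    have hab : a ≠ b := by rintro rfl; exact hb.2 ha.1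
    have hb' : b ∉ Y.erase a := fun h => hb.2 (mem_of_mem_erase h)
    have hcard : #(Y.erase a) + 1 = #Y := card_erase_add_one ha.1
    -- Replacing `a` by `b` either loses `P`, which is the wanted exchange, or gives a set closer to
    -- `Y'` to which induction applies.
    by_cases hP : P (insert b (Y.erase a))
    · have hsub : insert b (Y.erase a) ⊆ Y ∪ Y' := by
        intro i hi
        rw [mem_insert, mem_erase] at hi
        rw [mem_union]
        rcases hi with rfl | hi
        · exact Or.inr hb.1
        · exact Or.inl hi.2
      obtain ⟨S, c, d, h1, h2, h3, h4, h5, h6, h7, h8⟩ := ih (Y := insert b (Y.erase a))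
        (by rw [card_insert_of_notMem hb', hcard, hc]) hP (by
          have : Y' \ insert b (Y.erase a) = (Y' \ Y).erase b := by
            ext i
            simp only [mem_sdiff, mem_insert, mem_erase, not_or, not_and]
            constructor
            · rintro ⟨h1, h2, h3⟩
              exact ⟨h2, h1, fun h => h3 (fun h' => ha.2 (h' ▸ h1)) h⟩
            · rintro ⟨h1, h2, h3⟩
              exact ⟨h2, h1, fun _ h => h3 h⟩
          rw [this, card_erase_of_mem (mem_sdiff.2 hb), hk]; rfl)
      refine ⟨S, c, d, h1, h2, h3, ?_, ?_, ?_, h7, h8⟩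
      · rw [h4, card_insert_of_notMem hb', hcard]
      · exact h5.trans (union_subset hsub subset_union_right)
      · exact h6.trans (union_subset hsub subset_union_right)
    · refine ⟨Y.erase a, a, b, notMem_erase a Y, hb', hab, hcard, ?_, ?_, ?_, hP⟩
      · rw [insert_erase ha.1]; exact subset_union_left
      · intro i hi
        rw [mem_insert, mem_erase] at hi
        rw [mem_union]
        rcases hi with rfl | hi
        · exact Or.inr hb.1
        · exact Or.inl hi.2
      · rwa [insert_erase ha.1]

/-- Connectivity of the Kneser graph on the `k`-subsets of `U`. -/
lemma kneser_connected {U : Finset (Fin n)} {k : ℕ} (hU : 2 * k + 1 ≤ #U)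
    (P : Finset (Fin n) → Prop)
    (hstep : ∀ S T, S ⊆ U → T ⊆ U → #S = k → #T = k → Disjoint S T → P S → P T)
    {S T : Finset (Fin n)} (hS : S ⊆ U) (hT : T ⊆ U) (hSk : #S = k) (hTk : #T = k) (hP : P S) :
    P T := by
  by_contra hPT
  obtain ⟨R, a, b, ha, hb, hab, hR, hRa, hRb, hPa, hPb⟩ :=
    exists_exchange P (hSk.trans hTk.symm) hP hPT
  have hsub := union_subset hS hT
  have hcard : #(insert a (insert b R)) = k + 1 := by
    rw [card_insert_of_notMem (by simp [ha, hab]), card_insert_of_notMem hb]; omega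
  -- The two sets of an exchange have k + 1 elements together, so `U` contains a k-set disjoint from
  -- both, and two steps through it carry `P` across the exchange.
  have hle : k ≤ #(U \ insert a (insert b R)) := by
    have := le_card_sdiff (insert a (insert b R)) U
    omega
  obtain ⟨V, hV, hVk⟩ := exists_subset_card_eq hle
  have hd : Disjoint V (insert a (insert b R)) :=
    disjoint_of_subset_left hV sdiff_disjoint
  have hVU : V ⊆ U := hV.trans sdiff_subset
  have hda : Disjoint (insert a R) V := (disjoint_of_subset_right
    (insert_subset_insert _ (subset_insert _ _)) hd).symm
  have hdb : Disjoint V (insert b R) := disjoint_of_subset_right (subset_insert _ _) hd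
  refine hPb (hstep V _ hVU (hRb.trans hsub) hVk ?_ hdb
    (hstep _ V (hRa.trans hsub) hVU ?_ hVk hda hPa))
  · rw [card_insert_of_notMem hb]; omega
  · rw [card_insert_of_notMem ha]; omega

/-- If the three-part inequality is tight on average, it is tight for every partition. -/
lemma PartitionFree.three_parts_tight (h : PartitionFree 𝓕) {P Q R : Finset (Fin n)}
    (hPQ : Disjoint P Q) (hPR : Disjoint P R) (hQR : Disjoint Q R) (hn : #P + #Q + #R = n)
    (ht : layerPair 𝓕 #P + layerPair 𝓕 #Q + layerPair 𝓕 #R = 4) :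
    indicatorOf 𝓕 P + indicatorOf 𝓕 Pᶜ + (indicatorOf 𝓕 Q + indicatorOf 𝓕 Qᶜ) +
      (indicatorOf 𝓕 R + indicatorOf 𝓕 Rᶜ) = 4 := by
  have huniv : P ∪ Q ∪ R = univ := by
    rw [← card_eq_iff_eq_univ, card_union_of_disjoint (disjoint_union_left.2 ⟨hPR, hQR⟩),
      card_union_of_disjoint hPQ, hn, Fintype.card_fin]
  have hmem : ∀ i, i ∈ P ∨ i ∈ Q ∨ i ∈ R := fun i => by
    have := mem_univ i
    rw [← huniv] at this
    simpa [or_assoc] using this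
  have hP : Pᶜ = Q ∪ R := by
    ext i
    have := hmem i
    have h1 : i ∈ P → i ∉ Q := fun hi => disjoint_left.1 hPQ hi
    have h2 : i ∈ P → i ∉ R := fun hi => disjoint_left.1 hPR hi
    simp only [mem_compl, mem_union]; tauto
  have hQ : Qᶜ = P ∪ R := by
    ext i
    have := hmem i
    have h1 : i ∈ P → i ∉ Q := fun hi => disjoint_left.1 hPQ hi
    have h2 : i ∈ Q → i ∉ R := fun hi => disjoint_left.1 hQR hi
    simp only [mem_compl, mem_union]; tauto
  have hR : Rᶜ = P ∪ Q := by
    ext i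
    have := hmem i
    have h1 : i ∈ P → i ∉ R := fun hi => disjoint_left.1 hPR hi
    have h2 : i ∈ Q → i ∉ R := fun hi => disjoint_left.1 hQR hi
    simp only [mem_compl, mem_union]; tauto
  let s : Finset (Fin n) → Equiv.Perm (Fin n) → ℚ := fun S σ =>
    (indicatorOf 𝓕 (S.map (σ.symm : Fin n ↪ Fin n)) : ℚ)
  have hs : ∀ S, permAverage n (s S) = density 𝓕 #S := fun S => permAverage_indicatorOf_map 𝓕 S
  have key := eq_of_permAverage_eq
    (f := s P + s Pᶜ + (s Q + s Qᶜ) + (s R + s Rᶜ)) (g := fun _ => 4) (fun σ => by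
      simp only [Pi.add_apply, s]
      norm_cast
      have d1 := (disjoint_map (σ.symm : Fin n ↪ Fin n)).2 hPQ
      have d2 := (disjoint_map (σ.symm : Fin n ↪ Fin n)).2 hPR
      have d3 := (disjoint_map (σ.symm : Fin n ↪ Fin n)).2 hQR
      have h1 := h.indicatorOf_add_le d1 (C := Rᶜ.map (σ.symm : Fin n ↪ Fin n))
        (by rw [← map_union, hR])
      have h2 := h.indicatorOf_add_le d2 (C := Qᶜ.map (σ.symm : Fin n ↪ Fin n))
        (by rw [← map_union, hQ])
      have h3 := h.indicatorOf_add_le d3 (C := Pᶜ.map (σ.symm : Fin n ↪ Fin n))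
        (by rw [← map_union, hP])
      have z := fun S : Finset (Fin n) => indicatorOf_eq_zero_or_one (𝓕 := 𝓕) (S.map (σ.symm : Fin n ↪ Fin n))
      have z1 := z P
      have z2 := z Q
      have z3 := z R
      have z4 := z Pᶜ
      have z5 := z Qᶜ
      have z6 := z Rᶜ
      omega) (by
      simp only [map_add, hs, permAverage_const]
      rw [card_compl, card_compl, card_compl, Fintype.card_fin]
      exact ht)
  -- The identity permutation returns the given partition itself.
  have := congrFun key 1
  simp only [Pi.add_apply, s] at this
  norm_cast at this
  have hmap : ∀ S : Finset (Fin n),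
      S.map ((1 : Equiv.Perm (Fin n)).symm : Fin n ↪ Fin n) = S := fun S => by
    ext i; rw [Finset.mem_map_equiv]; rfl
  simpa only [hmap] using this

lemma exists_disjoint_card {S : Finset (Fin n)} {k : ℕ} (h : #S + k ≤ n) :
    ∃ T, #T = k ∧ Disjoint S T := by
  obtain ⟨T, hT, hTk⟩ := exists_subset_card_eq (s := Sᶜ) (n := k) (by
    rw [card_compl, Fintype.card_fin]; omega)
  exact ⟨T, hTk, (subset_compl_iff_disjoint_left.1 hT)⟩

lemma card_union_compl {P Q : Finset (Fin n)} (h : Disjoint P Q) :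
    #P + #Q + #(P ∪ Q)ᶜ = n := by
  have := card_le_univ (P ∪ Q)
  rw [Fintype.card_fin] at this
  rw [card_compl, Fintype.card_fin]
  rw [card_union_of_disjoint h] at *
  omega

lemma disjoint_compl_union_left {P Q : Finset (Fin n)} : Disjoint P (P ∪ Q)ᶜ :=
  disjoint_of_subset_left subset_union_left disjoint_compl_right

lemma disjoint_compl_union_right {P Q : Finset (Fin n)} : Disjoint Q (P ∪ Q)ᶜ :=
  disjoint_of_subset_left subset_union_right disjoint_compl_right

lemma union_compl_union {P Q : Finset (Fin n)} (h : Disjoint P Q) : P ∪ (P ∪ Q)ᶜ = Qᶜ := by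
  ext i
  have h1 : i ∈ P → i ∉ Q := fun hi => disjoint_left.1 h hi
  simp only [mem_compl, mem_union]; tauto

end

/-! ### The extremal families for n = 3m + 2 -/

section

variable {n m : ℕ} {𝓕 : Finset (Finset (Fin n))}

/-- A member X of size m excludes every disjoint m-set T together with its complement, since 2m-sets
and (m+2)-sets are all members. Tightness then puts into the family every (m+1)-set disjoint from X
and its complement. For two disjoint such sets Y, Z covering the complement of X, the set X ∪ Y is
the complement of Z, a contradiction. -/
lemma PartitionFree.not_mem_of_tight_two (h : PartitionFree 𝓕) (hn : n = 3 * m + 2) (hm : 2 ≤ m)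
    (full : ∀ S, m + 2 ≤ #S → #S ≤ 2 * m → S ∈ 𝓕)
    (tight : ∀ P Q R, Disjoint P Q → Disjoint P R → Disjoint Q R →
      #P = m → #Q = m + 1 → #R = m + 1 →
      indicatorOf 𝓕 P + indicatorOf 𝓕 Pᶜ + (indicatorOf 𝓕 Q + indicatorOf 𝓕 Qᶜ) +
        (indicatorOf 𝓕 R + indicatorOf 𝓕 Rᶜ) = 4) {X : Finset (Fin n)} (hXm : #X = m) :
    X ∉ 𝓕 := by
  intro hX
  have hA : ∀ T, #T = m → Disjoint X T → T ∉ 𝓕 ∧ Tᶜ ∉ 𝓕 := fun T hT hd => by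
    have hc := card_union_compl hd
    refine ⟨fun hTF => h.not_mem hX hTF hd rfl (full _ ?_ ?_), ?_⟩
    · rw [card_union_of_disjoint hd]; omega
    · rw [card_union_of_disjoint hd]; omega
    · exact h.not_mem hX (full _ (by omega) (by omega)) disjoint_compl_union_left
        (union_compl_union hd)
  have hB : ∀ Y, #Y = m + 1 → Disjoint X Y → Y ∈ 𝓕 ∧ Yᶜ ∈ 𝓕 := fun Y hY hd => by
    obtain ⟨T, hT, hdT⟩ := exists_disjoint_card (S := X ∪ Y) (k := m)
      (by rw [card_union_of_disjoint hd]; omega)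
    rw [disjoint_union_left] at hdT
    obtain ⟨h1, h2⟩ := hA T hT hdT.1
    have hc := card_union_compl hdT.2
    have := tight T Y (Y ∪ T)ᶜ hdT.2.symm disjoint_compl_union_right disjoint_compl_union_left
      hT hY (by omega)
    rw [indicatorOf_eq_zero.2 h1, indicatorOf_eq_zero.2 h2] at this
    rw [← indicatorOf_eq_one, ← indicatorOf_eq_one (S := Yᶜ)]
    have z := fun S : Finset (Fin n) => indicatorOf_le_one (𝓕 := 𝓕) S
    have z1 := z Y
    have z2 := z Yᶜ
    have z3 := z (Y ∪ T)ᶜ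
    have z4 := z (Y ∪ T)ᶜᶜ
    omega
  obtain ⟨Y, hY, hd⟩ := exists_disjoint_card (S := X) (k := m + 1) (by omega)
  have hc := card_union_compl hd
  have := (hB (X ∪ Y)ᶜ (by omega) disjoint_compl_union_left).2
  rw [compl_compl] at this
  exact h.not_mem hX (hB Y hY hd).1 hd rfl this

/-- Let e(Y) be the deficit of an (m+1)-set with its complement. Tightness says e(Y) + e(Y') = 1 or
0 for disjoint Y, Y', according to whether Y ∪ Y' is a member. Either e vanishes identically, or e
is the indicator of containing one element `a`, and `a` is then the doubled element. -/
lemma PartitionFree.structure_two (h : PartitionFree 𝓕) (hn : n = 3 * m + 2) (hm : 2 ≤ m)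
    (full : ∀ S, m + 2 ≤ #S → #S ≤ 2 * m → S ∈ 𝓕)
    (low : ∀ S, #S < m → S ∉ 𝓕) (high : ∀ S, 2 * m + 3 ≤ #S → S ∉ 𝓕)
    (tight : ∀ P Q R, Disjoint P Q → Disjoint P R → Disjoint Q R →
      #P = m → #Q = m + 1 → #R = m + 1 →
      indicatorOf 𝓕 P + indicatorOf 𝓕 Pᶜ + (indicatorOf 𝓕 Q + indicatorOf 𝓕 Qᶜ) +
        (indicatorOf 𝓕 R + indicatorOf 𝓕 Rᶜ) = 4) :
    (∀ G, G ∈ 𝓕 ↔ m + 1 ≤ #G ∧ #G ≤ 2 * m + 1) ∨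
      ∃ a, ∀ G, G ∈ 𝓕 ↔ m + 1 ≤ #(G.erase a) ∧ #(G.erase a) ≤ 2 * m + 1 := by
  have hmid : ∀ X, #X = m → X ∉ 𝓕 := fun X => h.not_mem_of_tight_two hn hm full tight
  have hlow : ∀ S, #S ≤ m → S ∉ 𝓕 := fun S hS => hS.lt_or_eq.elim (low S) (hmid S)
  obtain ⟨e, he⟩ : ∃ e : Finset (Fin n) → ℤ,
      ∀ Y, e Y = 2 - (indicatorOf 𝓕 Y + indicatorOf 𝓕 Yᶜ) := ⟨_, fun _ => rfl⟩
  have z0 : ∀ S, 0 ≤ indicatorOf 𝓕 S := fun S => indicatorOf_nonneg S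
  have z1 : ∀ S, indicatorOf 𝓕 S ≤ 1 := fun S => indicatorOf_le_one S
  have e0 : ∀ S, 0 ≤ e S := fun S => by
    have := z1 S; have := z1 Sᶜ; rw [he]; omega
  have hsplit : ∀ Y Y', #Y = m + 1 → #Y' = m + 1 → Disjoint Y Y' →
      e Y + e Y' = indicatorOf 𝓕 (Y ∪ Y') := fun Y Y' hY hY' hd => by
    have hc := card_union_compl hd
    have := tight (Y ∪ Y')ᶜ Y Y' disjoint_compl_union_left.symm disjoint_compl_union_right.symm hd
      (by omega) hY hY'
    rw [indicatorOf_eq_zero.2 (hmid _ (by omega)), compl_compl] at this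
    rw [he, he]; omega
  have hcompl : ∀ S : Finset (Fin n), #S + #Sᶜ = n := fun S => by
    rw [card_add_card_compl, Fintype.card_fin]
  have e1 : ∀ Y, #Y = m + 1 → e Y ≤ 1 := fun Y hY => by
    obtain ⟨Y', hY', hd⟩ := exists_disjoint_card (S := Y) (k := m + 1) (by omega)
    have := hsplit Y Y' hY hY' hd
    have := e0 Y'
    have := z1 (Y ∪ Y')
    omega
  have emem : ∀ Y, e Y = 0 → Y ∈ 𝓕 ∧ Yᶜ ∈ 𝓕 := fun Y hY => by
    rw [← indicatorOf_eq_one, ← indicatorOf_eq_one (S := Yᶜ)]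
    have := he Y
    have := z1 Y
    have := z1 Yᶜ
    omega
  -- every `(2m+2)`-set is the disjoint union of two `(m+1)`-sets
  have hhalf : ∀ G T V : Finset (Fin n), #G = 2 * m + 2 → T ⊆ V → V ⊆ G → #T ≤ m + 1 →
      m + 1 ≤ #V →
      ∃ Y Y', T ⊆ Y ∧ Y ⊆ V ∧ #Y = m + 1 ∧ #Y' = m + 1 ∧ Disjoint Y Y' ∧ Y ∪ Y' = G :=
    fun G T V hG hTV hVG hT hV => by
    obtain ⟨Y, hTY, hYV, hY⟩ := exists_subsuperset_card_eq hTV hT hV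
    have hYG := hYV.trans hVG
    refine ⟨Y, G \ Y, hTY, hYV, hY, ?_, disjoint_sdiff, union_sdiff_of_subset hYG⟩
    have := card_sdiff_add_card_eq_card hYG
    omega
  by_cases hall : ∀ Y, #Y = m + 1 → e Y = 0
  · left
    intro G
    have hG := hcompl G
    by_cases h1 : #G ≤ m
    · exact iff_of_false (hlow G h1) (by omega)
    by_cases h2 : #G = m + 1
    · exact iff_of_true (emem G (hall G h2)).1 (by omega)
    by_cases h3 : #G ≤ 2 * m
    · exact iff_of_true (full G (by omega) h3) (by omega)
    by_cases h4 : #G = 2 * m + 1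
    · have := (emem Gᶜ (hall Gᶜ (by omega))).2
      rw [compl_compl] at this
      exact iff_of_true this (by omega)
    refine iff_of_false ?_ (by omega)
    by_cases h5 : #G = 2 * m + 2
    · obtain ⟨Y, Y', -, -, hY, hY', hd, rfl⟩ :=
        hhalf G ∅ G h5 (empty_subset _) subset_rfl (by simp) (by omega)
      have := hsplit Y Y' hY hY' hd
      rw [hall Y hY, hall Y' hY'] at this
      rw [← indicatorOf_eq_zero]
      omega
    · exact high G (by omega)
  right
  push Not at hall
  obtain ⟨Y₀, hY₀, hne⟩ := hall
  have hY₀e : e Y₀ = 1 := by have := e0 Y₀; have := e1 Y₀ hY₀; omega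
  obtain ⟨Y₁, hY₁, hd₀⟩ := exists_disjoint_card (S := Y₀) (k := m + 1) (by omega)
  have hY₁e : ¬ e Y₁ = 1 := by
    have := hsplit _ _ hY₀ hY₁ hd₀
    have := z1 (Y₀ ∪ Y₁)
    omega
  obtain ⟨S, a, b, ha, hb, hab, hS, -, -, hea, heb⟩ :=
    exists_exchange (fun Y => e Y = 1) (hY₀.trans hY₁.symm) hY₀e hY₁e
  refine ⟨a, ?_⟩
  have hU : ∀ S : Finset (Fin n), S ⊆ {a, b}ᶜ ↔ a ∉ S ∧ b ∉ S := fun S => by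
    rw [subset_compl_comm, insert_subset_iff, singleton_subset_iff, mem_compl, mem_compl]
  have hpair : #({a, b} : Finset (Fin n)) = 2 := card_pair hab
  -- For disjoint S, T the (2m+2)-set S ∪ T ∪ {a, b} splits in two ways, so e(S+a) + e(T+b) = e(S+b)
  -- + e(T+a). This carries the values 1 and 0 along edges of the Kneser graph.
  have hex : ∀ T, a ∉ T → b ∉ T → #T = m → e (insert a T) = 1 ∧ e (insert b T) = 0 := by
    intro T haT hbT hT
    refine kneser_connected (U := {a, b}ᶜ) (k := m) ?_
      (fun T => e (insert a T) = 1 ∧ e (insert b T) = 0) ?_ ((hU S).2 ⟨ha, hb⟩)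
      ((hU T).2 ⟨haT, hbT⟩) (by omega) hT ⟨hea, ?_⟩
    · have := hcompl {a, b}; omega
    · intro S T hS hT hSm hTm hd hP
      rw [hU] at hS hT
      have c : ∀ {x : Fin n} {R : Finset (Fin n)}, x ∉ R → #R = m → #(insert x R) = m + 1 :=
        fun hx hR => by rw [card_insert_of_notMem hx, hR]
      have d1 : Disjoint (insert a S) (insert b T) := by
        rw [disjoint_insert_left, disjoint_insert_right]
        exact ⟨by simp [hab, hT.1], hS.2, hd⟩
      have d2 : Disjoint (insert b S) (insert a T) := by
        rw [disjoint_insert_left, disjoint_insert_right]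
        exact ⟨by simp [hab.symm, hT.2], hS.1, hd⟩
      have u : insert a S ∪ insert b T = insert b S ∪ insert a T := by
        ext i; simp only [mem_union, mem_insert]; tauto
      have s1 := hsplit _ _ (c hS.1 hSm) (c hT.2 hTm) d1
      have s2 := hsplit _ _ (c hS.2 hSm) (c hT.1 hTm) d2
      rw [u] at s1
      have := z1 (insert b S ∪ insert a T)
      have := e0 (insert b T)
      omega
    · have := e0 (insert b S)
      have := e1 (insert b S) (by rw [card_insert_of_notMem hb]; omega)
      omega
  have hea1 : ∀ Y, #Y = m + 1 → a ∈ Y → b ∉ Y → e Y = 1 := fun Y hY haY hbY => by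
    have := (hex (Y.erase a) (notMem_erase a Y) (fun h => hbY (mem_of_mem_erase h))
      (by rw [card_erase_of_mem haY]; omega)).1
    rwa [insert_erase haY] at this
  have hebz : ∀ Y, #Y = m + 1 → a ∉ Y → e Y = 0 := fun Y hY haY => by
    by_cases hbY : b ∈ Y
    · have := (hex (Y.erase b) (fun h => haY (mem_of_mem_erase h)) (notMem_erase b Y)
        (by rw [card_erase_of_mem hbY]; omega)).2
      rwa [insert_erase hbY] at this
    · obtain ⟨T, hT, hd⟩ := exists_disjoint_card (S := insert a (insert b Y)) (k := m) (by
        have := card_insert_le a (insert b Y)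
        have := card_insert_le b Y
        omega)
      rw [disjoint_insert_left, disjoint_insert_left] at hd
      have hc : #(insert a T) = m + 1 := by rw [card_insert_of_notMem hd.1, hT]
      have := hsplit Y (insert a T) hY hc (disjoint_insert_right.2 ⟨haY, hd.2.2⟩)
      rw [(hex T hd.1 hd.2.1 hT).1] at this
      have := z1 (Y ∪ insert a T)
      have := e0 Y
      omega
  have hlarge : ∀ G, #G = 2 * m + 2 → (G ∈ 𝓕 ↔ a ∈ G) := fun G hG => by
    by_cases haG : a ∈ G
    · refine iff_of_true ?_ haG
      obtain ⟨Y, Y', hT, hV, hY, hY', hd, rfl⟩ := hhalf G {a} (G.erase b) hG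
        (by simp [haG, hab]) (erase_subset _ _) (by simp) (by
          have := pred_card_le_card_erase (s := G) (a := b)
          omega)
      have := hsplit Y Y' hY hY' hd
      rw [hea1 Y hY (singleton_subset_iff.1 hT) (fun hb => notMem_erase b _ (hV hb))] at this
      rw [← indicatorOf_eq_one]
      have := e0 Y'
      have := z1 (Y ∪ Y')
      omega
    · refine iff_of_false ?_ haG
      obtain ⟨Y, Y', -, -, hY, hY', hd, rfl⟩ :=
        hhalf G ∅ G hG (empty_subset _) subset_rfl (by simp) (by omega)
      have := hsplit Y Y' hY hY' hd
      rw [mem_union, not_or] at haG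
      rw [hebz Y hY haG.1, hebz Y' hY' haG.2] at this
      rw [← indicatorOf_eq_zero]
      omega
  have hea : ∀ Y, #Y = m + 1 → a ∈ Y → e Y = 1 := fun Y hY haY => by
    obtain ⟨Y', hY', hd⟩ := exists_disjoint_card (S := Y) (k := m + 1) (by omega)
    have := hsplit Y Y' hY hY' hd
    rw [hebz Y' hY' (disjoint_left.1 hd haY), indicatorOf_eq_one.2 ((hlarge _
      (by rw [card_union_of_disjoint hd]; omega)).2 (mem_union_left _ haY))] at this
    omega
  have hsmall : ∀ Y, #Y = m + 1 → a ∈ Y → Y ∉ 𝓕 ∧ Yᶜ ∈ 𝓕 := fun Y hY haY => by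
    obtain ⟨Y', hY', hd⟩ := exists_disjoint_card (S := Y) (k := m + 1) (by omega)
    -- Of the pair `Y`, `Yᶜ` exactly one is a member. It is not `Y`: the disjoint `Y'` and the union
    -- `Y ∪ Y'` are members.
    have hYF : Y ∉ 𝓕 := fun hYF =>
      h.not_mem hYF (emem Y' (hebz Y' hY' (disjoint_left.1 hd haY))).1 hd rfl
        ((hlarge _ (by rw [card_union_of_disjoint hd]; omega)).2 (mem_union_left _ haY))
    refine ⟨hYF, ?_⟩
    have h1 := hea Y hY haY
    rw [he, indicatorOf_eq_zero.2 hYF] at h1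
    rw [← indicatorOf_eq_one]
    omega
  intro G
  have hG := hcompl G
  by_cases haG : a ∈ G
  · have hca : a ∉ Gᶜ := by rwa [mem_compl, not_not]
    rw [card_erase_of_mem haG]
    by_cases h1 : #G ≤ m
    · exact iff_of_false (hlow G h1) (by omega)
    by_cases h2 : #G = m + 1
    · exact iff_of_false (hsmall G h2 haG).1 (by omega)
    by_cases h3 : #G ≤ 2 * m
    · exact iff_of_true (full G (by omega) h3) (by omega)
    by_cases h4 : #G = 2 * m + 1
    · have := (emem Gᶜ (hebz Gᶜ (by omega) hca)).2
      rw [compl_compl] at this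
      exact iff_of_true this (by omega)
    by_cases h5 : #G = 2 * m + 2
    · exact iff_of_true ((hlarge G h5).2 haG) (by omega)
    · exact iff_of_false (high G (by omega)) (by omega)
  · have hca : a ∈ Gᶜ := mem_compl.2 haG
    rw [erase_eq_of_notMem haG]
    by_cases h1 : #G ≤ m
    · exact iff_of_false (hlow G h1) (by omega)
    by_cases h2 : #G = m + 1
    · exact iff_of_true (emem G (hebz G h2 haG)).1 (by omega)
    by_cases h3 : #G ≤ 2 * m
    · exact iff_of_true (full G (by omega) h3) (by omega)
    by_cases h4 : #G = 2 * m + 1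
    · have := (hsmall Gᶜ (by omega) hca).2
      rw [compl_compl] at this
      exact iff_of_true this (by omega)
    by_cases h5 : #G = 2 * m + 2
    · exact iff_of_false (fun hF => haG ((hlarge G h5).1 hF)) (by omega)
    · exact iff_of_false (high G (by omega)) (by omega)

end

/-! ### Pointwise exchange equations for n = 3m -/

section

variable {n m : ℕ} {𝓕 : Finset (Finset (Fin n))}

/-- The difference of the two sets has a size at which every set is a member, so `R` would be a
forbidden union. -/
lemma PartitionFree.indicatorOf_subset_le (h : PartitionFree 𝓕)
    (full : ∀ S, m + 1 ≤ #S → #S + 1 ≤ 2 * m → S ∈ 𝓕) {P R : Finset (Fin n)} (hPR : P ⊆ R)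
    (h1 : #P + m + 1 ≤ #R) (h2 : #R + 1 ≤ #P + 2 * m) :
    indicatorOf 𝓕 P + indicatorOf 𝓕 R ≤ 1 := by
  have hc := card_sdiff_add_card_eq_card hPR
  have := h.indicatorOf_add_le (A := P) (B := R \ P) (C := R) disjoint_sdiff
    (union_sdiff_of_subset hPR)
  rw [indicatorOf_eq_one.2 (full (R \ P) (by omega) (by omega))] at this
  omega

/-- The configuration inequality on the four lowest undetermined layer types. -/
lemma PartitionFree.exchange_le (h : PartitionFree 𝓕) (hm : 3 ≤ m)
    (full : ∀ S, m + 1 ≤ #S → #S + 1 ≤ 2 * m → S ∈ 𝓕) {A B C : Finset (Fin n)}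
    (hA : #A = m) (hB : #B = m) (hC : #C = m) (hAB : #(A ∩ B) + 1 = m)
    (hAC : Disjoint A C) (hBC : Disjoint B C) :
    indicatorOf 𝓕 B * (1 - indicatorOf 𝓕 A) + indicatorOf 𝓕 A + indicatorOf 𝓕 C +
      2 * indicatorOf 𝓕 (A ∩ B) + indicatorOf 𝓕 (A ∪ C) + indicatorOf 𝓕 (B ∪ C) +
      indicatorOf 𝓕 (A ∪ B ∪ C) ≤ 3 := by
  have hWC : Disjoint (A ∩ B) C := disjoint_of_subset_left inter_subset_left hAC
  have cAC := card_union_of_disjoint hAC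
  have cBC := card_union_of_disjoint hBC
  have cWC := card_union_of_disjoint hWC
  have cAB := card_union_add_card_inter A B
  have cV := card_union_of_disjoint (disjoint_union_left.2 ⟨hAC, hBC⟩)
  have s := fun P R => h.indicatorOf_subset_le full (P := P) (R := R)
  -- If `A ∩ B` is a member, then `C` and all three unions are excluded. If `A ∪ B ∪ C` is one, then
  -- all smaller sets listed are excluded. Otherwise membership of `C` with `A` or `B` excludes the
  -- corresponding union. Each case leaves at most 3.
  have s1 := s (A ∩ B) (A ∪ C) (inter_subset_left.trans subset_union_left) (by omega) (by omega)
  have s2 := s (A ∩ B) (B ∪ C) (inter_subset_right.trans subset_union_left) (by omega) (by omega)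
  have s3 := s (A ∩ B) (A ∪ B ∪ C)
    (inter_subset_left.trans (subset_union_left.trans subset_union_left)) (by omega) (by omega)
  have s4 := s A (A ∪ B ∪ C) (subset_union_left.trans subset_union_left) (by omega) (by omega)
  have s5 := s B (A ∪ B ∪ C) (subset_union_right.trans subset_union_left) (by omega) (by omega)
  have s6 := s C (A ∪ B ∪ C) subset_union_right (by omega) (by omega)
  have s7 := h.indicatorOf_add_le hWC rfl
  rw [indicatorOf_eq_one.2 (full (A ∩ B ∪ C) (by omega) (by omega))] at s7
  have s8 := h.indicatorOf_add_le hAC rfl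
  have s9 := h.indicatorOf_add_le hBC rfl
  have z0 := fun S : Finset (Fin n) => indicatorOf_nonneg (𝓕 := 𝓕) S
  have := z0 (A ∩ B)
  have := z0 (A ∪ C)
  have := z0 (B ∪ C)
  have := z0 C
  have := z0 (A ∪ B ∪ C)
  rcases indicatorOf_eq_zero_or_one (𝓕 := 𝓕) A with hA' | hA' <;>
    rcases indicatorOf_eq_zero_or_one (𝓕 := 𝓕) B with hB' | hB' <;>
    rw [hA', hB'] <;> omega

/-- With coefficient 1 at `A ∩ B` the average is already 3 by `avg`, while
`PartitionFree.exchange_le` gives the pointwise bound 3 even with coefficient 2. So equality holds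
everywhere; comparing the two shows that `A ∩ B` is not a member. -/
lemma PartitionFree.exchange_tight (h : PartitionFree 𝓕) (hm : 3 ≤ m)
    (full : ∀ S, m + 1 ≤ #S → #S + 1 ≤ 2 * m → S ∈ 𝓕)
    (avg : ∀ X X', #X = m → #X' = m → #(X ∩ X') + 1 = m →
      exchangeAverage 𝓕 X X' + 2 * density 𝓕 m + density 𝓕 (m - 1) + 2 * density 𝓕 (2 * m) +
        density 𝓕 (2 * m + 1) = 3) {A B C : Finset (Fin n)}
    (hA : #A = m) (hB : #B = m) (hC : #C = m) (hAB : #(A ∩ B) + 1 = m)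
    (hAC : Disjoint A C) (hBC : Disjoint B C) :
    indicatorOf 𝓕 B * (1 - indicatorOf 𝓕 A) + indicatorOf 𝓕 A + indicatorOf 𝓕 C +
      indicatorOf 𝓕 (A ∩ B) + indicatorOf 𝓕 (A ∪ C) + indicatorOf 𝓕 (B ∪ C) +
      indicatorOf 𝓕 (A ∪ B ∪ C) = 3 := by
  let s : Finset (Fin n) → Equiv.Perm (Fin n) → ℚ := fun S σ =>
    (indicatorOf 𝓕 (S.map (σ.symm : Fin n ↪ Fin n)) : ℚ)
  have hs : ∀ S, permAverage n (s S) = density 𝓕 #S := fun S => permAverage_indicatorOf_map 𝓕 S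
  have cAC := card_union_of_disjoint hAC
  have cBC := card_union_of_disjoint hBC
  have cAB := card_union_add_card_inter A B
  have cV := card_union_of_disjoint (disjoint_union_left.2 ⟨hAC, hBC⟩)
  have key := eq_of_permAverage_eq
    (f := s B * (1 - s A) + s A + s C + s (A ∩ B) + s (A ∪ C) + s (B ∪ C) + s (A ∪ B ∪ C))
    (g := fun _ => 3) (fun σ => by
      have := h.exchange_le hm full (A := A.map (σ.symm : Fin n ↪ Fin n))
        (B := B.map (σ.symm : Fin n ↪ Fin n)) (C := C.map (σ.symm : Fin n ↪ Fin n))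
        (by rw [card_map, hA]) (by rw [card_map, hB]) (by rw [card_map, hC])
        (by rw [← map_inter, card_map, hAB]) ((disjoint_map _).2 hAC) ((disjoint_map _).2 hBC)
      simp only [← map_inter, ← map_union] at this
      have := indicatorOf_nonneg (𝓕 := 𝓕) ((A ∩ B).map (σ.symm : Fin n ↪ Fin n))
      simp only [Pi.add_apply, Pi.mul_apply, Pi.sub_apply, Pi.one_apply, s]
      norm_cast
      linarith) (by
      have e : permAverage n (s B * (1 - s A)) = exchangeAverage 𝓕 B A := rfl
      simp only [map_add, hs, permAverage_const, e]
      rw [cV, cAC, cBC, hA, hB, hC, show #(A ∩ B) = m - 1 by omega,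
        show #(A ∪ B) + m = 2 * m + 1 by omega, show m + m = 2 * m by ring]
      have := avg B A hB hA (by rwa [inter_comm])
      linarith)
  have := congrFun key 1
  simp only [Pi.add_apply, Pi.mul_apply, Pi.sub_apply, Pi.one_apply, s] at this
  norm_cast at this
  have hmap : ∀ S : Finset (Fin n),
      S.map ((1 : Equiv.Perm (Fin n)).symm : Fin n ↪ Fin n) = S := fun S => by
    ext i; rw [Finset.mem_map_equiv]; rfl
  simpa only [hmap] using this

/-- In an `(m+1)`-set `T` disjoint from `C`, deleting one of two elements. -/
lemma PartitionFree.erase_tight (h : PartitionFree 𝓕) (hm : 3 ≤ m)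
    (full : ∀ S, m + 1 ≤ #S → #S + 1 ≤ 2 * m → S ∈ 𝓕)
    (avg : ∀ X X', #X = m → #X' = m → #(X ∩ X') + 1 = m →
      exchangeAverage 𝓕 X X' + 2 * density 𝓕 m + density 𝓕 (m - 1) + 2 * density 𝓕 (2 * m) +
        density 𝓕 (2 * m + 1) = 3) {T C : Finset (Fin n)} {a b : Fin n} (hT : #T = m + 1)
    (hC : #C = m) (hTC : Disjoint T C) (ha : a ∈ T) (hb : b ∈ T) (hab : a ≠ b) :
    (T.erase a).erase b ∉ 𝓕 ∧
    indicatorOf 𝓕 (T.erase b) * (1 - indicatorOf 𝓕 (T.erase a)) + indicatorOf 𝓕 (T.erase a) +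
      indicatorOf 𝓕 C + indicatorOf 𝓕 (T.erase a ∪ C) + indicatorOf 𝓕 (T.erase b ∪ C) +
      indicatorOf 𝓕 (T ∪ C) = 3 := by
  have hA : #(T.erase a) = m := by rw [card_erase_of_mem ha, hT]; rfl
  have hB : #(T.erase b) = m := by rw [card_erase_of_mem hb, hT]; rfl
  have hi : T.erase a ∩ T.erase b = (T.erase a).erase b := by
    ext i; simp only [mem_inter, mem_erase]; tauto
  have hu : T.erase a ∪ T.erase b = T := by
    ext i
    simp only [mem_union, mem_erase]
    constructor
    · tauto
    · intro h
      by_cases hia : i = a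
      · exact Or.inr ⟨hia ▸ hab, h⟩
      · exact Or.inl ⟨hia, h⟩
  have hW : #(T.erase a ∩ T.erase b) + 1 = m := by
    rw [hi, card_erase_add_one (mem_erase.2 ⟨hab.symm, hb⟩), hA]
  have dA := disjoint_of_subset_left (erase_subset a T) hTC
  have dB := disjoint_of_subset_left (erase_subset b T) hTC
  have h1 := h.exchange_le hm full hA hB hC hW dA dB
  have h2 := h.exchange_tight hm full avg hA hB hC hW dA dB
  rw [hi, hu] at h1 h2
  have h3 : indicatorOf 𝓕 ((T.erase a).erase b) = 0 := by
    have := indicatorOf_nonneg (𝓕 := 𝓕) ((T.erase a).erase b)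
    linarith
  exact ⟨indicatorOf_eq_zero.1 h3, by linarith⟩

end

/-! ### All sets of size 2m are members when n = 3m -/

section

variable {n m : ℕ} {𝓕 : Finset (Finset (Fin n))}

/-- If the exchange equations hold, every `2m`-set belongs to the family. -/
lemma PartitionFree.mem_of_card_eq_two_mul (h : PartitionFree 𝓕) (hn : n = 3 * m) (hm : 3 ≤ m)
    (full : ∀ S, m + 1 ≤ #S → #S + 1 ≤ 2 * m → S ∈ 𝓕)
    (tight : ∀ T C a b, #T = m + 1 → #C = m → Disjoint T C → a ∈ T → b ∈ T → a ≠ b →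
      indicatorOf 𝓕 (T.erase b) * (1 - indicatorOf 𝓕 (T.erase a)) + indicatorOf 𝓕 (T.erase a) +
        indicatorOf 𝓕 C + indicatorOf 𝓕 (T.erase a ∪ C) + indicatorOf 𝓕 (T.erase b ∪ C) +
        indicatorOf 𝓕 (T ∪ C) = 3) {D : Finset (Fin n)} (hD : #D = 2 * m) : D ∈ 𝓕 := by
  have hcompl : ∀ S : Finset (Fin n), #S + #Sᶜ = n := fun S => by
    rw [card_add_card_compl, Fintype.card_fin]
  -- For a missing 2m-set D, apply the equation to T = (D \ C) + b and C. If D + b were a member,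
  -- the m-sets involved would be excluded and the sum would be at most 2; so it is not, and all
  -- remaining terms must be 1.
  have hmain : ∀ D, #D = 2 * m → D ∉ 𝓕 → ∀ C ⊆ D, #C = m → ∀ a ∈ D, a ∉ C → ∀ b, b ∉ D →
      C ∈ 𝓕 ∧ insert b (D.erase a) ∈ 𝓕 := by
    intro D hD hDF C hCD hC a ha haC b hb
    have hbD : b ∉ D \ C := fun hh => hb (mem_sdiff.1 hh).1
    have haD : a ∈ D \ C := mem_sdiff.2 ⟨ha, haC⟩
    have hba : b ≠ a := by rintro rfl; exact hb ha
    have hDC : #(D \ C) = m := by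
      have := card_sdiff_add_card_eq_card hCD; omega
    have hT : #(insert b (D \ C)) = m + 1 := by
      rw [card_insert_of_notMem hbD, hDC]
    have hTC : Disjoint (insert b (D \ C)) C :=
      disjoint_insert_left.2 ⟨fun hh => hb (hCD hh), sdiff_disjoint⟩
    have hab' : a ∈ insert b (D \ C) := mem_insert_of_mem haD
    have hbb := mem_insert_self b (D \ C)
    have key := tight _ C b a hT hC hTC hbb hab' hba
    have e1 : (insert b (D \ C)).erase b = D \ C := erase_insert hbD
    have e2 : (insert b (D \ C)).erase a ∪ C = insert b (D.erase a) := by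
      ext i
      have : i ∈ C → i ∈ D := fun hi => hCD hi
      have : i = a → i ∉ C := by rintro rfl; exact haC
      have : i = b → i ≠ a := by rintro rfl; exact hba
      simp only [mem_union, mem_erase, mem_insert, mem_sdiff]; tauto
    rw [e1, e2, sdiff_union_of_subset hCD, indicatorOf_eq_zero.2 hDF] at key
    have cu : #(insert b (D \ C) ∪ C) = 2 * m + 1 := by
      rw [card_union_of_disjoint hTC]; omega
    have s1 := h.indicatorOf_subset_le full (P := C) subset_union_right (R := insert b (D \ C) ∪ C)
      (by omega) (by omega)
    have s2 := h.indicatorOf_subset_le full (P := D \ C) (R := insert b (D \ C) ∪ C)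
      ((subset_insert _ _).trans subset_union_left) (by omega) (by omega)
    have s3 := h.indicatorOf_subset_le full (P := (insert b (D \ C)).erase a)
      (R := insert b (D \ C) ∪ C) ((erase_subset _ _).trans subset_union_left)
      (by rw [card_erase_of_mem hab']; omega) (by rw [card_erase_of_mem hab']; omega)
    rw [← indicatorOf_eq_one, ← indicatorOf_eq_one (S := insert b (D.erase a))]
    have z0 := fun S : Finset (Fin n) => indicatorOf_nonneg (𝓕 := 𝓕) S
    have z1 := fun S : Finset (Fin n) => indicatorOf_le_one (𝓕 := 𝓕) S
    have := z0 (insert b (D \ C) ∪ C)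
    have := z0 C
    have := z1 C
    have := z1 (insert b (D.erase a))
    rcases indicatorOf_eq_zero_or_one (𝓕 := 𝓕) (D \ C) with hA' | hA' <;>
      rcases indicatorOf_eq_zero_or_one (𝓕 := 𝓕) ((insert b (D \ C)).erase a) with hB' | hB' <;>
      rw [hA', hB'] at key <;> omega
  have hsub : ∀ D, #D = 2 * m → D ∉ 𝓕 → ∀ C ⊆ D, #C = m → C ∈ 𝓕 := by
    intro D hD hDF C hCD hC
    obtain ⟨a, ha⟩ : (D \ C).Nonempty := by
      rw [← card_pos]; have := card_sdiff_add_card_eq_card hCD; omega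
    obtain ⟨b, hb⟩ : Dᶜ.Nonempty := by
      rw [← card_pos]; have := hcompl D; omega
    rw [mem_sdiff] at ha
    exact (hmain D hD hDF C hCD hC a ha.1 ha.2 b (mem_compl.1 hb)).1
  have hswap : ∀ D, #D = 2 * m → D ∉ 𝓕 → ∀ a ∈ D, ∀ b, b ∉ D → insert b (D.erase a) ∈ 𝓕 := by
    intro D hD hDF a ha b hb
    obtain ⟨C, hC, hCm⟩ := exists_subset_card_eq (s := D.erase a) (n := m)
      (by rw [card_erase_of_mem ha]; omega)
    exact (hmain D hD hDF C (hC.trans (erase_subset _ _)) hCm a ha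
      (fun hh => notMem_erase a D (hC hh)) b hb).2
  by_contra hDF
  -- Otherwise an equation whose three m-sets all leave D forces its (2m+1)-set to be a member,
  -- although that set contains the m-set T ⊆ D, which is a member by `hsub`.
  obtain ⟨X, hX, hXm, hXD⟩ : ∃ X ∈ 𝓕, #X = m ∧ ¬ X ⊆ D := by
    by_contra! hall
    have hout : ∀ X, #X = m → ∀ p ∈ X, p ∉ D → indicatorOf 𝓕 X = 0 := fun X hX p hp hpD =>
      indicatorOf_eq_zero.2 fun hXF => hpD (hall X hXF hX hp)
    obtain ⟨p, hp, q, hq, hpq⟩ := one_lt_card.1 (show 1 < #Dᶜ by have := hcompl D; omega)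
    rw [mem_compl] at hp hq
    obtain ⟨T, hT, hTm⟩ := exists_subset_card_eq (s := D) (n := m) (by omega)
    obtain ⟨C, hC, hCm⟩ := exists_subset_card_eq (s := D \ T) (n := m - 1) (by
      have := card_sdiff_add_card_eq_card hT; omega)
    obtain ⟨a, ha, b, hb, hab⟩ := one_lt_card.1 (show 1 < #T by omega)
    have hpT : p ∉ T := fun hh => hp (hT hh)
    have hCD : C ⊆ D := hC.trans sdiff_subset
    have hdis : Disjoint T C := (disjoint_of_subset_left hC sdiff_disjoint).symm
    have hTc : #(insert p T) = m + 1 := by rw [card_insert_of_notMem hpT, hTm]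
    have hCc : #(insert q C) = m := by
      rw [card_insert_of_notMem (fun hh => hq (hCD hh))]; omega
    have hd : Disjoint (insert p T) (insert q C) := by
      rw [disjoint_insert_left, disjoint_insert_right, mem_insert, not_or]
      exact ⟨⟨hpq, fun hh => hp (hCD hh)⟩, fun hh => hq (hT hh), hdis⟩
    have ha' := mem_insert_of_mem (b := p) ha
    have hb' := mem_insert_of_mem (b := p) hb
    have key := tight _ _ a b hTc hCc hd ha' hb' hab
    have hpe : ∀ x ∈ T, p ∈ (insert p T).erase x := fun x hx =>
      mem_erase.2 ⟨by rintro rfl; exact hpT hx, mem_insert_self _ _⟩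
    rw [hout _ hCc q (mem_insert_self _ _) hq,
      hout _ (by rw [card_erase_of_mem ha', hTc]; rfl) p (hpe a ha) hp,
      hout ((insert p T).erase b) (by rw [card_erase_of_mem hb', hTc]; rfl) p (hpe b hb) hp] at key
    have cu : #(insert p T ∪ insert q C) = 2 * m + 1 := by
      rw [card_union_of_disjoint hd]; omega
    have s1 := h.indicatorOf_subset_le full (P := T) (R := insert p T ∪ insert q C)
      ((subset_insert _ _).trans subset_union_left) (by omega) (by omega)
    rw [indicatorOf_eq_one.2 (hsub D hD hDF T hT hTm)] at s1
    have := indicatorOf_le_one (𝓕 := 𝓕) ((insert p T).erase a ∪ insert q C)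
    have := indicatorOf_le_one (𝓕 := 𝓕) ((insert p T).erase b ∪ insert q C)
    omega
  -- There is room for an (m+1)-set R in D \ X. Every X ∪ (R - c) is missing, but two of these
  -- differ by one exchange, against `hswap`.
  have hcard : m + 1 ≤ #(D \ X) := by
    have h1 := card_sdiff_add_card_inter D X
    have h2 : #(D ∩ X) < #X := card_lt_card ⟨inter_subset_right, fun hh =>
      hXD (hh.trans inter_subset_left)⟩
    omega
  obtain ⟨R, hR, hRm⟩ := exists_subset_card_eq hcard
  obtain ⟨a, ha, b, hb, hab⟩ := one_lt_card.1 (show 1 < #R by omega)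
  have hdR : Disjoint X R := (disjoint_of_subset_left hR sdiff_disjoint).symm
  have hXR : ∀ c ∈ R, #(X ∪ R.erase c) = 2 * m ∧ X ∪ R.erase c ∉ 𝓕 := fun c hc => by
    have hd := disjoint_of_subset_right (erase_subset c R) hdR
    have hcm : #(R.erase c) = m := by rw [card_erase_of_mem hc, hRm]; rfl
    refine ⟨by rw [card_union_of_disjoint hd]; omega, ?_⟩
    exact h.not_mem hX (hsub D hD hDF _ (((erase_subset c R).trans hR).trans sdiff_subset) hcm)
      hd rfl
  have haX : a ∉ X := disjoint_right.1 hdR ha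
  have hbX : b ∉ X := disjoint_right.1 hdR hb
  have := hswap _ (hXR b hb).1 (hXR b hb).2 a
    (mem_union_right _ (mem_erase.2 ⟨hab, ha⟩)) b (by simp [hbX])
  refine (hXR a ha).2 ?_
  convert this using 1
  ext i
  have h1 : i = a → i ∉ X := by rintro rfl; exact haX
  have h2 : i = a → i ≠ b := by rintro rfl; exact hab
  have h3 : i = b → i ∈ R := by rintro rfl; exact hb
  simp only [mem_union, mem_erase, mem_insert]; tauto

end

/-! ### The extremal families for n = 3m -/

section

variable {n m : ℕ} {𝓕 : Finset (Finset (Fin n))}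

/-- With all 2m-sets present, the exchange equation says that exactly one of three things holds: T -
a or T - b is a member, C is a member, T ∪ C is a member. Without members of size m this gives
`kleitmanFamily`; otherwise an exchange at which membership is lost produces the special element
`x`. -/
lemma PartitionFree.structure_zero (h : PartitionFree 𝓕) (hn : n = 3 * m) (hm : 3 ≤ m)
    (full : ∀ S, m + 1 ≤ #S → #S + 1 ≤ 2 * m → S ∈ 𝓕)
    (low : ∀ S, #S + 2 ≤ m → S ∉ 𝓕) (high : ∀ S, 2 * m + 2 ≤ #S → S ∉ 𝓕)
    (avg : ∀ X X', #X = m → #X' = m → #(X ∩ X') + 1 = m →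
      exchangeAverage 𝓕 X X' + 2 * density 𝓕 m + density 𝓕 (m - 1) + 2 * density 𝓕 (2 * m) +
        density 𝓕 (2 * m + 1) = 3) :
    (∀ G, G ∈ 𝓕 ↔ m + 1 ≤ #G ∧ #G ≤ 2 * m + 1) ∨
      ∃ x, ∀ G, G ∈ 𝓕 ↔ (#G = m ∧ x ∈ G) ∨
        (m + 1 ≤ #G ∧ #G ≤ 2 * m + 1) ∧ ¬ (#G = 2 * m + 1 ∧ x ∈ G) := by
  have hmem := fun D => h.mem_of_card_eq_two_mul hn hm full
    (fun T C a b hT hC hd ha hb hab => (h.erase_tight hm full avg hT hC hd ha hb hab).2) (D := D)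
  have tight : ∀ T C a b, #T = m + 1 → #C = m → Disjoint T C → a ∈ T → b ∈ T → a ≠ b →
      indicatorOf 𝓕 (T.erase b) * (1 - indicatorOf 𝓕 (T.erase a)) + indicatorOf 𝓕 (T.erase a) +
        indicatorOf 𝓕 C + indicatorOf 𝓕 (T ∪ C) = 1 := fun T C a b hT hC hd ha hb hab => by
    have key := (h.erase_tight hm full avg hT hC hd ha hb hab).2
    have c : ∀ x ∈ T, #(T.erase x ∪ C) = 2 * m := fun x hx => by
      rw [card_union_of_disjoint (disjoint_of_subset_left (erase_subset x T) hd),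
        card_erase_of_mem hx]
      omega
    rw [indicatorOf_eq_one.2 (hmem _ (c a ha)), indicatorOf_eq_one.2 (hmem _ (c b hb))] at key
    linarith
  have hlow : ∀ S, #S + 1 ≤ m → S ∉ 𝓕 := fun S hS => by
    rcases hS.lt_or_eq with hS | hS
    · exact low S hS
    obtain ⟨P, hP, hd⟩ := exists_disjoint_card (S := S) (k := 2) (by omega)
    obtain ⟨a, b, hab, rfl⟩ := card_eq_two.1 hP
    rw [disjoint_insert_right, disjoint_singleton_right] at hd
    have haS : a ∉ insert b S := by simp [hab, hd.1]
    have hT : #(insert a (insert b S)) = m + 1 := by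
      rw [card_insert_of_notMem haS, card_insert_of_notMem hd.2]; omega
    obtain ⟨C, hC, hdC⟩ := exists_disjoint_card (S := insert a (insert b S)) (k := m) (by omega)
    have := (h.erase_tight hm full avg hT hC hdC (mem_insert_self a _)
      (mem_insert_of_mem (mem_insert_self b _)) hab).1
    rwa [erase_insert haS, erase_insert hd.2] at this
  have hparts : ∀ V S : Finset (Fin n), #V = 2 * m + 1 → S ⊆ V → #S ≤ m →
      ∃ T C a b, S ⊆ T.erase a ∧ #T = m + 1 ∧ #C = m ∧ Disjoint T C ∧ a ∈ T ∧ b ∈ T ∧ a ≠ b ∧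
        T ∪ C = V := fun V S hV hSV hS => by
    obtain ⟨T, hST, hTV, hT⟩ := exists_subsuperset_card_eq hSV (n := m + 1) (by omega) (by omega)
    obtain ⟨a, ha⟩ : (T \ S).Nonempty := by
      rw [← card_pos]; have := card_sdiff_add_card_eq_card hST; omega
    rw [mem_sdiff] at ha
    obtain ⟨b, hb⟩ : (T.erase a).Nonempty := by
      rw [← card_pos, card_erase_of_mem ha.1]; omega
    rw [mem_erase] at hb
    refine ⟨T, V \ T, a, b, subset_erase.2 ⟨hST, ha.2⟩, hT, ?_, disjoint_sdiff, ha.1, hb.2,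
      hb.1.symm, union_sdiff_of_subset hTV⟩
    have := card_sdiff_add_card_eq_card hTV
    omega
  have z0 : ∀ S, 0 ≤ indicatorOf 𝓕 S := fun S => indicatorOf_nonneg S
  have z1 : ∀ S, indicatorOf 𝓕 S ≤ 1 := fun S => indicatorOf_le_one S
  by_cases hall : ∀ X, #X = m → X ∉ 𝓕
  · left
    intro G
    by_cases h1 : #G + 1 ≤ m
    · exact iff_of_false (hlow G h1) (by omega)
    by_cases h2 : #G = m
    · exact iff_of_false (hall G h2) (by omega)
    by_cases h3 : #G + 1 ≤ 2 * m
    · exact iff_of_true (full G (by omega) h3) (by omega)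
    by_cases h4 : #G = 2 * m
    · exact iff_of_true (hmem G h4) (by omega)
    by_cases h5 : #G = 2 * m + 1
    · refine iff_of_true ?_ (by omega)
      obtain ⟨T, C, a, b, -, hT, hC, hd, ha, hb, hab, rfl⟩ :=
        hparts G ∅ h5 (empty_subset _) (by simp)
      have := tight T C a b hT hC hd ha hb hab
      rw [indicatorOf_eq_zero.2 (hall C hC),
        indicatorOf_eq_zero.2 (hall (T.erase a) (by rw [card_erase_of_mem ha]; omega)),
        indicatorOf_eq_zero.2 (hall (T.erase b) (by rw [card_erase_of_mem hb]; omega))] at this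
      rw [← indicatorOf_eq_one]
      omega
    · exact iff_of_false (high G (by omega)) (by omega)
  right
  push Not at hall
  obtain ⟨X, hX, hXF⟩ := hall
  obtain ⟨X', hX', hd⟩ := exists_disjoint_card (S := X) (k := m) (by omega)
  have hX'F : X' ∉ 𝓕 := fun hF =>
    h.not_mem hXF hF hd rfl (hmem _ (by rw [card_union_of_disjoint hd]; omega))
  obtain ⟨S, x, b, hx, hb, hxb, hS, -, -, hxS, hbS⟩ :=
    exists_exchange (· ∈ 𝓕) (hX.trans hX'.symm) hXF hX'F
  -- if some deletion of `T` other than that of `x` is in the family, so are all of them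
  have hstar : ∀ T C p, #T = m + 1 → #C = m → Disjoint T C → x ∈ T → T.erase x ∉ 𝓕 →
      p ∈ T → p ≠ x → C ∉ 𝓕 → T ∪ C ∉ 𝓕 → T.erase p ∈ 𝓕 :=
    fun T C p hT hC hd hxT hTx hp hpx hCF hVF => by
      have := tight T C p x hT hC hd hp hxT hpx
      rw [indicatorOf_eq_zero.2 hTx, indicatorOf_eq_zero.2 hCF, indicatorOf_eq_zero.2 hVF] at this
      rw [← indicatorOf_eq_one]
      omega
  have hnone : ∀ T C p, #T = m + 1 → #C = m → Disjoint T C → x ∈ T → T.erase x ∉ 𝓕 →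
      p ∈ T → p ≠ x → T.erase p ∈ 𝓕 → C ∉ 𝓕 ∧ T ∪ C ∉ 𝓕 :=
    fun T C p hT hC hd hxT hTx hp hpx hpF => by
      have := tight T C p x hT hC hd hp hxT hpx
      rw [indicatorOf_eq_zero.2 hTx, indicatorOf_eq_one.2 hpF] at this
      rw [← indicatorOf_eq_zero, ← indicatorOf_eq_zero (S := T ∪ C)]
      have := z0 C
      have := z0 (T ∪ C)
      omega
  have hins : ∀ S : Finset (Fin n), x ∉ S → #S = m → #(insert x S) = m + 1 := fun S hS hSm => by
    rw [card_insert_of_notMem hS, hSm]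
  have hU : ∀ S : Finset (Fin n), S ⊆ {x}ᶜ ↔ x ∉ S := fun S => by
    rw [subset_compl_comm, singleton_subset_iff, mem_compl]
  -- The property passes from S to a disjoint T because the equations for (S + x, T) and (T + x, S)
  -- share the same (2m+1)-set.
  have hP : ∀ S, x ∉ S → #S = m → S ∉ 𝓕 ∧ ∀ p ∈ S, (insert x S).erase p ∈ 𝓕 := by
    intro R hxR hR
    have hbS' : #(insert b S) = m := by rw [card_insert_of_notMem hb]; omega
    have hxbS : x ∉ insert b S := by simp [hxb, hx]
    refine kneser_connected (U := {x}ᶜ) (k := m) ?_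
      (fun S => S ∉ 𝓕 ∧ ∀ p ∈ S, (insert x S).erase p ∈ 𝓕) ?_ ((hU _).2 hxbS)
      ((hU R).2 hxR) hbS' hR ⟨hbS, ?_⟩
    · rw [card_compl, card_singleton, Fintype.card_fin]; omega
    · rintro S T hS hT hSm hTm hd ⟨hSF, hSp⟩
      rw [hU] at hS hT
      obtain ⟨p, hp⟩ : S.Nonempty := by rw [← card_pos]; omega
      have hpx : ∀ {p} {S : Finset (Fin n)}, x ∉ S → p ∈ S → p ≠ x := by
        rintro p S hS hp rfl; exact hS hp
      obtain ⟨h1, h2⟩ := hnone (insert x S) T p (hins S hS hSm) hTm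
        (disjoint_insert_left.2 ⟨hT, hd⟩) (mem_insert_self _ _) (by rwa [erase_insert hS])
        (mem_insert_of_mem hp) (hpx hS hp) (hSp p hp)
      refine ⟨h1, fun q hq => hstar (insert x T) S q (hins T hT hTm) hSm
        (disjoint_insert_left.2 ⟨hS, hd.symm⟩) (mem_insert_self _ _) (by rwa [erase_insert hT])
        (mem_insert_of_mem hq) (hpx hT hq) hSF ?_⟩
      rwa [insert_union, union_comm, ← insert_union]
    · have hT := hins _ hxbS hbS'
      obtain ⟨C, hC, hdC⟩ := exists_disjoint_card (S := insert x (insert b S)) (k := m) (by omega)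
      have hTx : (insert x (insert b S)).erase x ∉ 𝓕 := by rwa [erase_insert hxbS]
      obtain ⟨h1, h2⟩ := hnone _ C b hT hC hdC (mem_insert_self _ _) hTx
        (mem_insert_of_mem (mem_insert_self _ _)) hxb.symm (by
          rw [insert_comm, erase_insert (by simp [hxb.symm, hb])]; exact hxS)
      exact fun p hp => hstar _ C p hT hC hdC (mem_insert_self _ _) hTx (mem_insert_of_mem hp)
        (by rintro rfl; exact hxbS hp) h1 h2
  have hmid : ∀ G, #G = m → (G ∈ 𝓕 ↔ x ∈ G) := fun G hG => by
    by_cases hxG : x ∈ G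
    · refine iff_of_true ?_ hxG
      obtain ⟨p, hp, hd⟩ := exists_disjoint_card (S := G) (k := 1) (by omega)
      obtain ⟨p, rfl⟩ := card_eq_one.1 hp
      rw [disjoint_singleton_right] at hd
      have hxp : x ≠ p := by rintro rfl; exact hd hxG
      have := (hP (insert p (G.erase x)) (by simp [hxp]) (by
        rw [card_insert_of_notMem (fun hh => hd (mem_of_mem_erase hh)), card_erase_of_mem hxG]
        omega)).2 p (mem_insert_self _ _)
      rwa [insert_comm, insert_erase hxG, erase_insert hd] at this
    · exact iff_of_false (hP G hxG hG).1 hxG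
  have hbig : ∀ G, #G = 2 * m + 1 → (G ∈ 𝓕 ↔ x ∉ G) := fun G hG => by
    by_cases hxG : x ∈ G
    · refine iff_of_false ?_ (fun hh => hh hxG)
      obtain ⟨T, C, a, b, hsub, hT, hC, hd, ha, hb, hab, rfl⟩ :=
        hparts G {x} hG (by simpa using hxG) (by simp; omega)
      have := tight T C a b hT hC hd ha hb hab
      rw [indicatorOf_eq_one.2 ((hmid (T.erase a) (by rw [card_erase_of_mem ha]; omega)).2
        (singleton_subset_iff.1 hsub))] at this
      rw [← indicatorOf_eq_zero]
      have := z0 C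
      have := z0 (T ∪ C)
      omega
    · refine iff_of_true ?_ hxG
      obtain ⟨T, C, a, b, hsub, hT, hC, hd, ha, hb, hab, rfl⟩ :=
        hparts G ∅ hG (empty_subset _) (by simp)
      rw [mem_union, not_or] at hxG
      have hout : ∀ y ∈ T, T.erase y ∉ 𝓕 := fun y hy hF => hxG.1 (mem_of_mem_erase
        ((hmid (T.erase y) (by rw [card_erase_of_mem hy]; omega)).1 hF))
      have := tight T C a b hT hC hd ha hb hab
      rw [indicatorOf_eq_zero.2 (fun hF => hxG.2 ((hmid C hC).1 hF)),
        indicatorOf_eq_zero.2 (hout a ha), indicatorOf_eq_zero.2 (hout b hb)] at this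
      rw [← indicatorOf_eq_one]
      omega
  refine ⟨x, fun G => ?_⟩
  by_cases h1 : #G + 1 ≤ m
  · exact iff_of_false (hlow G h1) (by omega)
  by_cases h2 : #G = m
  · rw [hmid G h2]
    constructor
    · exact fun hx => Or.inl ⟨h2, hx⟩
    · rintro (hx | hx)
      · exact hx.2
      · omega
  by_cases h3 : #G + 1 ≤ 2 * m
  · exact iff_of_true (full G (by omega) h3) (by omega)
  by_cases h4 : #G = 2 * m
  · exact iff_of_true (hmem G h4) (by omega)
  by_cases h5 : #G = 2 * m + 1
  · rw [hbig G h5]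
    constructor
    · exact fun hx => Or.inr ⟨by omega, fun hh => hx hh.2⟩
    · rintro (hx | hx)
      · omega
      · exact fun hxG => hx.2 ⟨h5, hxG⟩
  · exact iff_of_false (high G (by omega)) (by omega)

end

/-! ### The extremal families are partition-free and have the right size -/

section

variable {n m : ℕ}

lemma card_filter_card_mem_Icc (n a b : ℕ) :
    #({K | a ≤ #K ∧ #K ≤ b} : Finset (Finset (Fin n))) = ∑ t ∈ Icc a b, n.choose t := by
  rw [card_eq_sum_card_fiberwise (f := card) (t := Icc a b)
    (fun K hK => by simpa using hK)]
  refine sum_congr rfl fun t ht => ?_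
  rw [mem_Icc] at ht
  rw [filter_filter, ← Fintype.card_fin n, ← card_univ, ← card_powersetCard, card_univ,
    Fintype.card_fin]
  congr 1
  ext K
  simp only [mem_filter, mem_univ, true_and, mem_powersetCard, subset_univ]
  omega

lemma card_filter_card_eq_and_mem (x : Fin n) (k : ℕ) :
    #({G | #G = k + 1 ∧ x ∈ G} : Finset (Finset (Fin n))) = (n - 1).choose k := by
  have hu : #(univ.erase x) = n - 1 := by
    rw [card_erase_of_mem (mem_univ x), card_univ, Fintype.card_fin]
  rw [← hu, ← card_powersetCard]
  symm
  refine card_bij (fun S _ => insert x S) ?_ ?_ ?_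
  · intro S hS
    rw [mem_powersetCard, subset_erase] at hS
    simp [card_insert_of_notMem hS.1.2, hS.2]
  · intro S hS T hT hST
    rw [mem_powersetCard, subset_erase] at hS hT
    rw [← erase_insert hS.1.2, hST, erase_insert hT.1.2]
  · intro G hG
    rw [mem_filter] at hG
    refine ⟨G.erase x, ?_, insert_erase hG.2.2⟩
    rw [mem_powersetCard, card_erase_of_mem hG.2.2, hG.2.1]
    exact ⟨erase_subset_erase _ (subset_univ _), rfl⟩

/-- Exchanging the sets through `x` of one layer for those of another of the same size. -/
lemma card_exchange_layers (x : Fin n) {a b p q : ℕ} (hp : a ≤ p + 1 ∧ p + 1 ≤ b)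
    (hq : ¬ (a ≤ q + 1 ∧ q + 1 ≤ b)) (hpq : (n - 1).choose p = (n - 1).choose q)
    {𝓕 : Finset (Finset (Fin n))}
    (h𝓕 : ∀ G, G ∈ 𝓕 ↔ (#G = q + 1 ∧ x ∈ G) ∨ (a ≤ #G ∧ #G ≤ b) ∧ ¬ (#G = p + 1 ∧ x ∈ G)) :
    #𝓕 = ∑ t ∈ Icc a b, n.choose t := by
  have h : 𝓕 = ({G | #G = q + 1 ∧ x ∈ G} : Finset (Finset (Fin n))) ∪
      (({K | a ≤ #K ∧ #K ≤ b} : Finset (Finset (Fin n))) \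
        ({G | #G = p + 1 ∧ x ∈ G} : Finset (Finset (Fin n)))) := by
    ext G; rw [h𝓕]; simp
  have hsub : ({G | #G = p + 1 ∧ x ∈ G} : Finset (Finset (Fin n))) ⊆
      ({K | a ≤ #K ∧ #K ≤ b} : Finset (Finset (Fin n))) := fun G hG => by
    simp only [mem_filter, mem_univ, true_and] at hG ⊢
    omega
  rw [h, card_union_of_disjoint, card_filter_card_eq_and_mem, ← hpq,
    ← card_filter_card_eq_and_mem x, ← card_filter_card_mem_Icc, add_comm,
    card_sdiff_add_card_eq_card hsub]
  rw [disjoint_left]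
  intro G h1 h2
  simp only [mem_filter, mem_univ, true_and, mem_sdiff] at h1 h2
  omega

lemma partitionFree_iff {𝓕 : Finset (Finset (Fin n))} :
    PartitionFree 𝓕 ↔ ∀ A ∈ 𝓕, ∀ B ∈ 𝓕, Disjoint A B → A ∪ B ∉ 𝓕 := by
  constructor
  · exact fun h A hA B hB hd => h.not_mem hA hB hd rfl
  · rintro h ⟨_, h0, A, hA, B, hB, hd, rfl⟩
    exact h A hA B hB (disjoint_iff_inter_eq_empty.2 hd) h0

lemma mem_kleitmanFamily {G : Finset (Fin n)} (hn : n / 3 = m) :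
    G ∈ kleitmanFamily n ↔ m + 1 ≤ #G ∧ #G ≤ 2 * m + 1 := by
  simp [kleitmanFamily, hn]

lemma partitionFree_kleitmanFamily (n : ℕ) : PartitionFree (kleitmanFamily n) := by
  refine partitionFree_iff.2 fun A hA B hB hd => ?_
  rw [mem_kleitmanFamily rfl] at *
  rw [card_union_of_disjoint hd]
  omega

lemma card_kleitmanFamily (hn : n / 3 = m) :
    #(kleitmanFamily n) = ∑ t ∈ Icc (m + 1) (2 * m + 1), n.choose t := by
  rw [← card_filter_card_mem_Icc, kleitmanFamily, hn]

lemma mem_permuteFamily {σ : Equiv.Perm (Fin n)} {𝓕 : Finset (Finset (Fin n))}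
    {G : Finset (Fin n)} : G ∈ permuteFamily σ 𝓕 ↔ G.image σ.symm ∈ 𝓕 := by
  rw [permuteFamily, mem_image]
  constructor
  · rintro ⟨F, hF, rfl⟩
    simpa [image_image] using hF
  · exact fun h => ⟨_, h, by simp [image_image]⟩

lemma card_filter_castSucc_mem (F : Finset (Fin (n + 1))) :
    #({i | i.castSucc ∈ F} : Finset (Fin n)) = #(F.erase (Fin.last n)) := by
  rw [← card_map Fin.castSuccEmb]
  congr 1
  ext i
  refine Fin.lastCases ?_ (fun j => ?_) i
  · simp [Fin.castSucc_ne_last]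
  · simp [Fin.castSucc_ne_last]

/-- A double ignores the last element, so its image under `σ` ignores `σ (Fin.last n)` and depends
on `σ` only through that element. -/
lemma mem_permuteFamily_doubleFamily (hn : n / 3 = m) {σ : Equiv.Perm (Fin (n + 1))}
    {G : Finset (Fin (n + 1))} :
    G ∈ permuteFamily σ (doubleFamily (kleitmanFamily n)) ↔
      m + 1 ≤ #(G.erase (σ (Fin.last n))) ∧ #(G.erase (σ (Fin.last n))) ≤ 2 * m + 1 := by
  have h : (G.image σ.symm).erase (Fin.last n) = (G.erase (σ (Fin.last n))).image σ.symm := by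
    rw [image_erase σ.symm.injective, Equiv.symm_apply_apply]
  rw [mem_permuteFamily, doubleFamily, mem_filter, and_iff_right (mem_univ _),
    mem_kleitmanFamily hn, card_filter_castSucc_mem, h, card_image_of_injective _ σ.symm.injective]

lemma partitionFree_of_mem_iff_card_erase {𝓕 : Finset (Finset (Fin n))} {a : Fin n}
    (h : ∀ G, G ∈ 𝓕 ↔ m + 1 ≤ #(G.erase a) ∧ #(G.erase a) ≤ 2 * m + 1) : PartitionFree 𝓕 := by
  refine partitionFree_iff.2 fun A hA B hB hd => ?_
  rw [h] at *
  rw [erase_union_distrib, card_union_of_disjoint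
    (disjoint_of_subset_left (erase_subset a A) (disjoint_of_subset_right (erase_subset a B) hd))]
  omega

/-- Compared with all sets of sizes m + 1 to 2m + 1, the (m+1)-sets through `a` are exchanged for
the (2m+2)-sets through `a`, and C(3m+1, m) = C(3m+1, 2m+1). -/
lemma card_of_mem_iff_card_erase (hn : n = 3 * m + 2) {𝓕 : Finset (Finset (Fin n))} {a : Fin n}
    (h : ∀ G, G ∈ 𝓕 ↔ m + 1 ≤ #(G.erase a) ∧ #(G.erase a) ≤ 2 * m + 1) :
    #𝓕 = ∑ t ∈ Icc (m + 1) (2 * m + 1), n.choose t := by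
  refine card_exchange_layers a (p := m) (q := 2 * m + 1) (by omega) (by omega) ?_ fun G => ?_
  · exact Nat.choose_symm_of_eq_add (by omega)
  · rw [h]
    by_cases ha : a ∈ G
    · rw [card_erase_of_mem ha]
      simp only [ha, and_true]
      omega
    · rw [erase_eq_of_notMem ha]
      simp [ha]

lemma mem_kleitmanTilde (hn : n / 3 = m) {x : Fin n} {G : Finset (Fin n)} :
    G ∈ kleitmanTilde n x ↔ (#G = m ∧ x ∈ G) ∨
      (m + 1 ≤ #G ∧ #G ≤ 2 * m + 1) ∧ ¬ (#G = 2 * m + 1 ∧ x ∈ G) := by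
  rw [kleitmanTilde, mem_union, mem_sdiff, mem_kleitmanFamily hn]
  simp [hn]

/-- Of two disjoint members at most one contains `x`, so at most one has size m. Their union is then
too large, or it has size 2m + 1 and contains `x`, and such sets were deleted. -/
lemma partitionFree_kleitmanTilde (x : Fin n) : PartitionFree (kleitmanTilde n x) := by
  refine partitionFree_iff.2 fun A hA B hB hd => ?_
  rw [mem_kleitmanTilde rfl] at *
  have hx : x ∈ A → x ∉ B := fun h => disjoint_left.1 hd h
  have cA : x ∈ A → 0 < #A := fun h => card_pos.2 ⟨x, h⟩
  have cB : x ∈ B → 0 < #B := fun h => card_pos.2 ⟨x, h⟩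
  rw [card_union_of_disjoint hd, mem_union]
  by_cases h1 : x ∈ A <;> by_cases h2 : x ∈ B <;>
    simp only [h1, h2, or_true, or_false, and_true, and_false, not_false_eq_true,
      not_true, forall_const, false_or] at * <;> omega

lemma card_kleitmanTilde (hn : n = 3 * m) (hm : 1 ≤ m) (x : Fin n) :
    #(kleitmanTilde n x) = ∑ t ∈ Icc (m + 1) (2 * m + 1), n.choose t := by
  refine card_exchange_layers x (p := 2 * m) (q := m - 1) (by omega) (by omega) ?_ fun G => ?_
  · exact Nat.choose_symm_of_eq_add (by omega)
  · rw [mem_kleitmanTilde (m := m) (by omega), Nat.sub_add_cancel hm]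

end

/-! ### Characterisation of equality and the theorem -/

theorem PartitionFree.extremal_two {m : ℕ} (hm : 6 ≤ m) (𝓕 : Finset (Finset (Fin (3 * m + 2)))) :
    (PartitionFree 𝓕 ∧
        #𝓕 = ∑ t ∈ Finset.Icc (m + 1) (2 * m + 1), (3 * m + 2).choose t) ↔
      (𝓕 = kleitmanFamily (3 * m + 2) ∨
        ∃ σ : Equiv.Perm (Fin (3 * m + 2)),
          𝓕 = permuteFamily σ (doubleFamily (kleitmanFamily (3 * m + 1)))) := by
  constructor
  · rintro ⟨h, hc⟩
    obtain ⟨hfull, hempty, hlayer⟩ := h.eq_two rfl hm hc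
    have hcompl : ∀ S : Finset (Fin (3 * m + 2)), #S ≤ 3 * m + 2 := fun S => by
      simpa using card_le_univ S
    rcases h.structure_two (m := m) rfl (by omega)
      (fun S h1 h2 => (density_eq_one_iff (by omega)).1 (hfull _ h1 h2) S rfl)
      (fun S hS => density_eq_zero_iff.1 (hempty _ hS).1 S rfl)
      (fun S hS => density_eq_zero_iff.1 (hempty (3 * m + 2 - #S) (by omega)).2 S
        (by have := hcompl S; omega))
      (fun P Q R h1 h2 h3 hP hQ hR => h.three_parts_tight h1 h2 h3 (by omega) (by
        rw [hP, hQ, hR, hlayer]; ring)) with hG | ⟨a, hG⟩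
    · left
      ext G
      rw [hG, mem_kleitmanFamily (m := m) (by omega)]
    · right
      -- Any permutation taking the last element to `a` would serve.
      refine ⟨Equiv.swap (Fin.last (3 * m + 1)) a, ?_⟩
      ext G
      rw [hG, mem_permuteFamily_doubleFamily (m := m) (by omega), Equiv.swap_apply_left]
  · rintro (rfl | ⟨σ, rfl⟩)
    · exact ⟨partitionFree_kleitmanFamily _, card_kleitmanFamily (by omega)⟩
    · have hG := fun G => mem_permuteFamily_doubleFamily (n := 3 * m + 1) (m := m) (by omega)
        (σ := σ) (G := G)
      exact ⟨partitionFree_of_mem_iff_card_erase hG, card_of_mem_iff_card_erase rfl hG⟩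

theorem PartitionFree.extremal_zero {m : ℕ} (hm : 6 ≤ m) (𝓕 : Finset (Finset (Fin (3 * m)))) :
    (PartitionFree 𝓕 ∧
        #𝓕 = ∑ t ∈ Finset.Icc (m + 1) (2 * m + 1), (3 * m).choose t) ↔
      (𝓕 = kleitmanFamily (3 * m) ∨
        ∃ x : Fin (3 * m), 𝓕 = kleitmanTilde (3 * m) x) := by
  constructor
  · rintro ⟨h, hc⟩
    obtain ⟨hfull, hempty, havg⟩ := h.eq_zero rfl hm hc
    have hcompl : ∀ S : Finset (Fin (3 * m)), #S ≤ 3 * m := fun S => by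
      simpa using card_le_univ S
    rcases h.structure_zero (m := m) rfl (by omega)
      (fun S h1 h2 => (density_eq_one_iff (by omega)).1 (hfull _ h1 (by omega)) S rfl)
      (fun S hS => density_eq_zero_iff.1 (hempty _ hS).1 S rfl)
      (fun S hS => density_eq_zero_iff.1 (hempty (3 * m - #S) (by omega)).2 S
        (by have := hcompl S; omega)) havg with hG | ⟨x, hG⟩
    · left
      ext G
      rw [hG, mem_kleitmanFamily (m := m) (by omega)]
    · right
      refine ⟨x, ?_⟩
      ext G
      rw [hG, mem_kleitmanTilde (m := m) (by omega)]
  · rintro (rfl | ⟨x, rfl⟩)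
    · exact ⟨partitionFree_kleitmanFamily _, card_kleitmanFamily (by omega)⟩
    · exact ⟨partitionFree_kleitmanTilde x, card_kleitmanTilde rfl (by omega) x⟩

theorem theorem1 (m : ℕ) (hm : 6 ≤ m) :
    (∀ n : ℕ, n = 3 * m + 2 ∨ n = 3 * m →
      ∀ 𝓕 : Finset (Finset (Fin n)), PartitionFree 𝓕 →
        #𝓕 ≤ ∑ t ∈ Finset.Icc (m + 1) (2 * m + 1), n.choose t) ∧
    (∀ 𝓕 : Finset (Finset (Fin (3 * m + 2))),
      (PartitionFree 𝓕 ∧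
          #𝓕 = ∑ t ∈ Finset.Icc (m + 1) (2 * m + 1), (3 * m + 2).choose t) ↔
        (𝓕 = kleitmanFamily (3 * m + 2) ∨
          ∃ σ : Equiv.Perm (Fin (3 * m + 2)),
            𝓕 = permuteFamily σ (doubleFamily (kleitmanFamily (3 * m + 1))))) ∧
    (∀ 𝓕 : Finset (Finset (Fin (3 * m))),
      (PartitionFree 𝓕 ∧
          #𝓕 = ∑ t ∈ Finset.Icc (m + 1) (2 * m + 1), (3 * m).choose t) ↔
        (𝓕 = kleitmanFamily (3 * m) ∨
          ∃ x : Fin (3 * m), 𝓕 = kleitmanTilde (3 * m) x)) := by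
  refine ⟨?_, PartitionFree.extremal_two hm, PartitionFree.extremal_zero hm⟩
  rintro n (hn | hn) 𝓕 h
  · exact h.card_le_two hn hm
  · exact h.card_le_zero hn hm
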